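/- Let $n\ge 2$ and let $(M,\langle\cdot,\cdot\rangle,I,\Psi)$ be a special almost Hermitian $2n$-manifold: a smooth Riemannian $2n$-manifold with a smooth orthogonal almost complex structure $I$ and a smooth complex volume form $\Psi=\psi_++i\psi_-$ of type $(n,0)$ (that is, $\Psi(IX_1,X_2,\dots,X_n)=i\,\Psi(X_1,\dots,X_n)$) and of unit length ($|\Psi(u_1,\dots,u_n)|=1$ for every unitary basis of a tangent space). Let $\nabla$ be the Levi-Civita connection, let $\xi_XY=-\tfrac12 I(\nabla_XI)Y$ and $\widetilde\nabla=\nabla+\xi$, and let $\overline\nabla$ be the minimal $SU(n)$-connection, i.e. the metric connection with $\overline\nabla I=0$, $\overline\nabla\Psi=0$ for which $\overline\nabla-\nabla$ takes values in $\mathfrak{su}(n)^\perp\subset\mathfrak{so}(2n)$. Then $\overline\nabla=\nabla+\xi+\eta$ with $\eta_XY=\hat\eta(X)IY$ for a one-form $\hat\eta$. With $R_{X,Y}=\nabla_{[X,Y]}-[\nabla_X,\nabla_Y]$, an orthonormal basis $e_1,\dots,e_{2n}$ of the tangent space, and summation over repeated indices, put $\mathrm{Ric}(X,Y)=\langle R_{X,e_i}Y,e_i\rangle$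 and $\mathrm{Ric}^*(X,Y)=\langle R_{X,e_i}IY,Ie_i\rangle$; for a bilinear form $b$ let $b_H(X,Y)=\tfrac12\big(b(X,Y)+b(IX,IY)\big)$; and let $d\hat\eta(X,Y)=X\hat\eta(Y)-Y\hat\eta(X)-\hat\eta([X,Y])$. Then $3\,\mathrm{Ric}^*_H+\mathrm{Ric}_H=T$, where $$\begin{aligned} T(X,Y)={}& 2n\,d\hat\eta(X,IY)-2n\,d\hat\eta(IX,Y)-\langle(\widetilde\nabla_{e_i}\xi)_XY,e_i\rangle+\langle(\widetilde\nabla_X\xi)_{e_i}Y,e_i\rangle\\ &-\langle(\widetilde\nabla_{e_i}\xi)_{IX}IY,e_i\rangle+\langle(\widetilde\nabla_{IX}\xi)_{e_i}IY,e_i\rangle-\langle\xi_{\xi_{e_i}X}Y,e_i\rangle+\langle\xi_{\xi_Xe_i}Y,e_i\rangle\\ &-\langle\xi_{\xi_{e_i}IX}IY,e_i\rangle+\langle\xi_{\xi_{IX}e_i}IY,e_i\rangle-2\langle\xi_Xe_i,\xi_{IY}Ie_i\rangle-2\langle\xi_Ye_i,\xi_{IX}Ie_i\rangle . \end{aligned}$$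 Consequently the intrinsic torsion determines the components of the curvature tensor $R(X,Y,Z,W)=\langle R_{X,Y}Z,W\rangle$ in $\mathcal K_1$ and $\mathcal K_2$, where $\mathcal K$ is the space of algebraic curvature tensors with values in $\mathfrak u(n)$, $\mathcal C_3\subset\mathcal K$ consists of those with values in $\mathfrak{su}(n)$, $\mathcal K_1$ is the space of $U(n)$-invariant elements of $\mathcal K$ orthogonal to $\mathcal C_3$, and $\mathcal K_2$ is the orthogonal complement of $\mathcal C_3+\mathcal K_1$ in $\mathcal K$. Explicitly, write $g=\langle\cdot,\cdot\rangle$, $\omega(X,Y)=g(X,IY)$ and, for a symmetric bilinear form $b$ with $b=b_H$, write $\beta(X,Y)=b(X,IY)$ and $$\begin{aligned} \Phi(b)(X,Y,Z,W)={}&g(X,Z)b(Y,W)+b(X,Z)g(Y,W)-g(Y,Z)b(X,W)-b(Y,Z)g(X,W)\\ &+\omega(X,Z)\beta(Y,W)+\beta(X,Z)\omega(Y,W)-\omega(Y,Z)\beta(X,W)-\beta(Y,Z)\omega(X,W)\\ &+2\,\omega(X,Y)\beta(Z,W)+2\,\beta(X,Y)\omega(Z,W). \end{aligned}$$ Then the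 orthogonal projections of $R$ to $\mathcal K_1$ and to $\mathcal K_2$ are, respectively, $$\frac{\operatorname{tr}T}{32\,n(n+1)}\,\Phi(g)\qquad\text{and}\qquad\frac1{8(n+2)}\,\Phi\Big(T-\frac{\operatorname{tr}T}{2n}\,g\Big).$$ -/

import Mathlib

open scoped Manifold ContDiff Bundle
open Bundle VectorField

noncomputable section

/-! ## Special almost Hermitian manifolds and their connections

The manifold `M` has real dimension `2 * n`, is smooth, and carries a smooth Riemannian metric
(an inner product `inner ℝ` on every tangent space). A vector field `X` is smooth at `x` when
`CMDiffAt ∞ (T% X) x`. For a covariant derivative `D`, the vector `(∇_X Y)(x)` is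
`D Y x (X x)`. A tangent vector `v` at `x` has the extension `FiberBundle.extend _ v`, a vector
field that is smooth near `x` and takes the value `v` at `x`; tensors defined by differentiating
vector fields are evaluated on such extensions. -/

namespace SAH

section Manifold

variable {n : ℕ} {E : Type*} [NormedAddCommGroup E] [NormedSpace ℝ E] [FiniteDimensional ℝ E]
  {H : Type*} [TopologicalSpace H] {I : ModelWithCorners ℝ E H}
  {M : Type*} [TopologicalSpace M] [ChartedSpace H M] [IsManifold I ∞ M]
  [RiemannianBundle (fun x : M ↦ TangentSpace I x)]
  [IsContMDiffRiemannianBundle I ∞ E (fun x : M ↦ TangentSpace I x)]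

/-- The extension of a tangent vector at `x` to a vector field that is smooth near `x`. -/
def ext {x : M} (v : TangentSpace I x) (y : M) : TangentSpace I y :=
  FiberBundle.extend E v y

variable (n I M) in
/-- A special almost Hermitian structure, that is, an `SU(n)`-structure, on the Riemannian
manifold `M`: a smooth orthogonal almost complex structure `J` and a smooth complex volume form
`Ψ = ψ₊ + i ψ₋`, which is a complex `n`-form of unit length on `(T_x M, J)`. -/
structure SpecialAlmostHermitian where
  /-- the almost complex structure -/
  J : Π x : M, TangentSpace I x →L[ℝ] TangentSpace I x
  J_J : ∀ (x : M) (v : TangentSpace I x), J x (J x v) = -v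
  J_inner : ∀ (x : M) (v w : TangentSpace I x),
    inner ℝ (J x v) (J x w) = inner ℝ v w
  J_smooth : ∀ (X : Π x : M, TangentSpace I x) (x : M),
    CMDiffAt ∞ (T% X) x → CMDiffAt ∞ (T% (fun y ↦ J y (X y))) x
  /-- the complex volume form -/
  Ψ : Π x : M, TangentSpace I x [⋀^Fin n]→ₗ[ℝ] ℂ
  Ψ_smooth : ∀ (X : Fin n → Π x : M, TangentSpace I x) (x : M),
    (∀ i, CMDiffAt ∞ (T% (X i)) x) →
      ContMDiffAt I 𝓘(ℝ, ℂ) ∞ (fun y ↦ Ψ y (fun i ↦ X i y)) x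
  /-- `Ψ` is complex multilinear. -/
  Ψ_J : ∀ (x : M) (v : Fin n → TangentSpace I x) (i : Fin n),
    Ψ x (Function.update v i (J x (v i))) = Complex.I * Ψ x v
  /-- `Ψ` has unit length: it takes a value of modulus one on every basis `u` that is unitary for
  the Hermitian product `⟨v, w⟩ + i ⟨v, J w⟩`. -/
  Ψ_unit : ∀ (x : M) (u : Fin n → TangentSpace I x),
    Orthonormal ℝ u → (∀ i j, inner ℝ (u i) (J x (u j)) = 0) → ‖Ψ x u‖ = 1

variable (I M) in
/-- Covariant derivatives on the tangent bundle of `M`. -/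
abbrev Connection :=
  CovariantDerivative I E
    (TangentSpace I : M → Type _)

/-- A connection is smooth if `∇_X Y` is smooth for smooth `X` and `Y`. -/
def IsSmooth (D : Connection I M) : Prop :=
  ∀ (X Y : Π x : M, TangentSpace I x) (x : M),
    CMDiffAt ∞ (T% X) x → CMDiffAt ∞ (T% Y) x → CMDiffAt ∞ (T% (fun y ↦ D Y y (X y))) x

/-- A connection is metric if `u ⟨X, Y⟩ = ⟨∇_u X, Y⟩ + ⟨X, ∇_u Y⟩` for vector fields `X`, `Y` that
are smooth at `x` and tangent vectors `u` at `x`. -/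
def IsMetric (D : Connection I M) : Prop :=
  ∀ (X Y : Π x : M, TangentSpace I x) (x : M) (u : TangentSpace I x),
    CMDiffAt ∞ (T% X) x → CMDiffAt ∞ (T% Y) x →
      d% (fun y ↦ (inner ℝ (X y) (Y y) : ℝ)) x u =
        inner ℝ (D X x u) (Y x) + inner ℝ (X x) (D Y x u)

/-- The Levi-Civita connection: smooth, metric and torsion-free. -/
structure IsLeviCivita (D : Connection I M) : Prop where
  smooth : IsSmooth D
  metric : IsMetric D
  torsion_free : D.torsion = 0

/-- The Lie algebra `su(n)` of the stabiliser of the metric, `J` and `Ψ` at `x`: skew-symmetric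
endomorphisms that commute with `J` and have complex trace zero. -/
def IsSU (S : SpecialAlmostHermitian n I M) (x : M)
    (B : TangentSpace I x →L[ℝ] TangentSpace I x) : Prop :=
  (∀ v w, inner ℝ (B v) w = -inner ℝ v (B w)) ∧
  (∀ v, B (S.J x v) = S.J x (B v)) ∧
  LinearMap.trace ℝ (TangentSpace I x)
    ((S.J x ∘L B : _ →L[ℝ] _) : _ →ₗ[ℝ] _) = 0

/-- The orthogonal complement of `su(n)` in `so(2n)` at `x`; the inner product of two
skew-symmetric endomorphisms `A`, `B` is a multiple of the trace of `A B`. -/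
def IsSUPerp (S : SpecialAlmostHermitian n I M) (x : M)
    (A : TangentSpace I x →L[ℝ] TangentSpace I x) : Prop :=
  (∀ v w, inner ℝ (A v) w = -inner ℝ v (A w)) ∧
  ∀ B, IsSU S x B → LinearMap.trace ℝ (TangentSpace I x)
    ((A ∘L B : _ →L[ℝ] _) : _ →ₗ[ℝ] _) = 0

/-- The difference `∇̄ - D` of two connections: `diff D Dbar x u` is the endomorphism
`v ↦ ∇̄_u v - D_u v` of `T_x M`. -/
def diff (D Dbar : Connection I M) (x : M) (u : TangentSpace I x) :
    TangentSpace I x →L[ℝ] TangentSpace I x :=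
  (Dbar.difference D x).flip u

/-- `Dbar` is the minimal `SU(n)`-connection, where `D` is the Levi-Civita connection: it is a
smooth connection for which the metric, `J` and `Ψ` are parallel, and `Dbar - D` takes values in
the orthogonal complement of `su(n)` in `so(2n)`. -/
structure IsMinimalSU (S : SpecialAlmostHermitian n I M) (D Dbar : Connection I M) : Prop where
  smooth : IsSmooth Dbar
  metric : IsMetric Dbar
  parallel_J : ∀ (Y : Π x : M, TangentSpace I x) (x : M)
    (u : TangentSpace I x), CMDiffAt ∞ (T% Y) x →
      Dbar (fun y ↦ S.J y (Y y)) x u = S.J x (Dbar Y x u)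
  parallel_Ψ : ∀ (Y : Fin n → Π x : M, TangentSpace I x) (x : M)
    (u : TangentSpace I x), (∀ i, CMDiffAt ∞ (T% (Y i)) x) →
      d% (fun y ↦ S.Ψ y (fun i ↦ Y i y)) x u =
        ∑ i, S.Ψ x (Function.update (fun j ↦ Y j x) i (Dbar (Y i) x u))
  perp : ∀ (x : M) (u : TangentSpace I x), IsSUPerp S x (diff D Dbar x u)

/-- The intrinsic `U(n)`-torsion `ξ_u v = -1/2 J (∇_u J) v`. -/
def xi (S : SpecialAlmostHermitian n I M) (D : Connection I M) (x : M)
    (u v : TangentSpace I x) : TangentSpace I x :=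
  -(1 / 2 : ℝ) • S.J x (D (fun y ↦ S.J y (ext v y)) x u - S.J x (D (ext v) x u))

/-- The one-form `η̂` with `η_u v = η̂(u) J v`, where `η = (∇̄ - ∇) - ξ`: since the trace of `ξ_u J`
is zero and that of `J J` is `-2n`, one has `η̂(u) = - tr ((∇̄ - ∇)_u J) / 2n`. -/
def etaHat (S : SpecialAlmostHermitian n I M) (D Dbar : Connection I M) (x : M)
    (u : TangentSpace I x) : ℝ :=
  -(1 / (2 * n : ℝ)) * LinearMap.trace ℝ (TangentSpace I x)
    ((diff D Dbar x u ∘L S.J x : _ →L[ℝ] _) : _ →ₗ[ℝ] _)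

/-- The exterior derivative of a one-form `a`:
`da(X, Y) = X (a Y) - Y (a X) - a [X, Y]`. -/
def dOne (a : Π x : M, TangentSpace I x → ℝ) (x : M)
    (u v : TangentSpace I x) : ℝ :=
  d% (fun y ↦ a y (ext v y)) x u - d% (fun y ↦ a y (ext u y)) x v
    - a x (mlieBracket I (ext u) (ext v) x)

/-- The minimal `U(n)`-connection `∇̃ = ∇ + ξ`; `nablaTilde S D Y x u = (∇̃_u Y)(x)`. -/
def nablaTilde (S : SpecialAlmostHermitian n I M) (D : Connection I M)
    (Y : Π x : M, TangentSpace I x) (x : M) (u : TangentSpace I x) :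
    TangentSpace I x :=
  D Y x u + xi S D x u (Y x)

/-- The tensor `(∇̃_u ξ)_v w = ∇̃_u (ξ_v w) - ξ_{∇̃_u v} w - ξ_v (∇̃_u w)`. -/
def nablaXi (S : SpecialAlmostHermitian n I M) (D : Connection I M) (x : M)
    (u v w : TangentSpace I x) : TangentSpace I x :=
  nablaTilde S D (fun y ↦ xi S D y (ext v y) (ext w y)) x u
    - xi S D x (nablaTilde S D (ext v) x u) w
    - xi S D x v (nablaTilde S D (ext w) x u)

/-- The curvature operator `R_{X,Y} Z = ∇_{[X,Y]} Z - ∇_X ∇_Y Z + ∇_Y ∇_X Z` on vector fields. -/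
def curvatureOp (D : Connection I M) (X Y Z : Π x : M, TangentSpace I x) (x : M) :
    TangentSpace I x :=
  D Z x (mlieBracket I X Y x)
    - D (fun y ↦ D Z y (Y y)) x (X x) + D (fun y ↦ D Z y (X y)) x (Y x)

/-- The curvature tensor `R(u, v, w, z) = ⟨R_{u,v} w, z⟩` at `x`. -/
def riem (D : Connection I M) (x : M) (u v w z : TangentSpace I x) : ℝ :=
  inner ℝ (curvatureOp D (ext u) (ext v) (ext w) x) z

/-- The Ricci curvature `Ric(u, v) = ∑ᵢ ⟨R_{u,eᵢ} v, eᵢ⟩`, `e` an orthonormal basis. -/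
def ric (D : Connection I M) (x : M)
    (e : OrthonormalBasis (Fin (2 * n)) ℝ (TangentSpace I x))
    (u v : TangentSpace I x) : ℝ :=
  ∑ i, riem D x u (e i) v (e i)

/-- The `*`-Ricci curvature `Ric*(u, v) = ∑ᵢ ⟨R_{u,eᵢ} Jv, Jeᵢ⟩`, `e` an orthonormal basis. -/
def ricStar (S : SpecialAlmostHermitian n I M) (D : Connection I M) (x : M)
    (e : OrthonormalBasis (Fin (2 * n)) ℝ (TangentSpace I x))
    (u v : TangentSpace I x) : ℝ :=
  ∑ i, riem D x u (e i) (S.J x v) (S.J x (e i))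

/-- The expression in `dη̂`, `∇̃ξ` and `ξ` (the intrinsic `SU(n)`-torsion `η + ξ` and its
derivatives) that gives `3 Ric*_H + Ric_H`. -/
def torsionForm (S : SpecialAlmostHermitian n I M) (D Dbar : Connection I M) (x : M)
    (e : OrthonormalBasis (Fin (2 * n)) ℝ (TangentSpace I x))
    (X Y : TangentSpace I x) : ℝ :=
  let J := S.J x
  let ξ := xi S D x
  let dξ := nablaXi S D x
  let dη := dOne (etaHat S D Dbar) x
  2 * n * dη X (J Y) - 2 * n * dη (J X) Y
    + ∑ i, (
      - inner ℝ (dξ (e i) X Y) (e i) + inner ℝ (dξ X (e i) Y) (e i)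
      - inner ℝ (dξ (e i) (J X) (J Y)) (e i) + inner ℝ (dξ (J X) (e i) (J Y)) (e i)
      - inner ℝ (ξ (ξ (e i) X) Y) (e i) + inner ℝ (ξ (ξ X (e i)) Y) (e i)
      - inner ℝ (ξ (ξ (e i) (J X)) (J Y)) (e i) + inner ℝ (ξ (ξ (J X) (e i)) (J Y)) (e i)
      - 2 * inner ℝ (ξ X (e i)) (ξ (J Y) (J (e i)))
      - 2 * inner ℝ (ξ Y (e i)) (ξ (J X) (J (e i))))

end Manifold

/-! ## Kähler curvature tensors on a Hermitian vector space

`V` is a real inner product space with an orthogonal complex structure `J` and an orthonormal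
basis `e`; in the theorem `V` is a tangent space. -/

section Algebra

variable {V : Type*} [NormedAddCommGroup V] [InnerProductSpace ℝ V] {n : ℕ}

/-- The Hermitian part `b_H` of a bilinear form `b`. -/
def hermPart (J : V → V) (b : V → V → ℝ) (u v : V) : ℝ :=
  (b u v + b (J u) (J v)) / 2

/-- The trace of a bilinear form. -/
def tr (e : OrthonormalBasis (Fin (2 * n)) ℝ V) (b : V → V → ℝ) : ℝ :=
  ∑ i, b (e i) (e i)

/-- Algebraic curvature tensors: quadrilinear forms with the symmetries of a Riemannian curvature
tensor. (Linearity in the other arguments follows from the symmetries.) -/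
structure IsCurvature (K : V → V → V → V → ℝ) : Prop where
  add : ∀ a a' b c d, K (a + a') b c d = K a b c d + K a' b c d
  smul : ∀ (t : ℝ) a b c d, K (t • a) b c d = t * K a b c d
  antisymm : ∀ a b c d, K b a c d = -K a b c d
  pair_symm : ∀ a b c d, K c d a b = K a b c d
  bianchi : ∀ a b c d, K a b c d + K b c a d + K c a b d = 0

/-- The space `𝒦` of Kähler curvature tensors: those with values in `u(n)`. -/
structure IsKahler (J : V → V) (K : V → V → V → V → ℝ) : Prop extends IsCurvature K where
  commute : ∀ a b c d, K a b (J c) (J d) = K a b c d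

/-- Kähler curvature tensors with values in `su(n)`. -/
structure IsCurSU (J : V → V) (e : OrthonormalBasis (Fin (2 * n)) ℝ V)
    (K : V → V → V → V → ℝ) : Prop extends IsKahler J K where
  traceless : ∀ a b, ∑ i, K a b (e i) (J (e i)) = 0

/-- The inner product of two four-tensors. -/
def pair (e : OrthonormalBasis (Fin (2 * n)) ℝ V) (K L : V → V → V → V → ℝ) : ℝ :=
  ∑ i, ∑ j, ∑ k, ∑ l, K (e i) (e j) (e k) (e l) * L (e i) (e j) (e k) (e l)

/-- The trivial `U(n)`-summand `𝒦₁` of `𝒦`: the `U(n)`-invariant Kähler curvature tensors that are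
orthogonal to those with values in `su(n)`. -/
structure IsK1 (J : V → V) (e : OrthonormalBasis (Fin (2 * n)) ℝ V)
    (K : V → V → V → V → ℝ) : Prop extends IsKahler J K where
  perp_su : ∀ B, IsCurSU J e B → pair e K B = 0
  invariant : ∀ g : V ≃ₗᵢ[ℝ] V, (∀ v, g (J v) = J (g v)) →
    ∀ a b c d, K (g a) (g b) (g c) (g d) = K a b c d

/-- The summand `𝒦₂` of `𝒦`: the orthogonal complement in `𝒦` of `𝒦₁` and of the curvature tensors
with values in `su(n)`. -/
structure IsK2 (J : V → V) (e : OrthonormalBasis (Fin (2 * n)) ℝ V)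
    (K : V → V → V → V → ℝ) : Prop extends IsKahler J K where
  perp_su : ∀ B, IsCurSU J e B → pair e K B = 0
  perp_K1 : ∀ B, IsK1 J e B → pair e K B = 0

/-- `A` is the component of `R` in the space of four-tensors described by `P`, that is, its
orthogonal projection. -/
def IsComponent (e : OrthonormalBasis (Fin (2 * n)) ℝ V)
    (P : (V → V → V → V → ℝ) → Prop) (R A : V → V → V → V → ℝ) : Prop :=
  P A ∧ ∀ B, P B → pair e (fun a b c d ↦ R a b c d - A a b c d) B = 0

/-- The Kähler curvature tensor `Φ(b)` built from a symmetric Hermitian form `b`, where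
`ω(u, v) = ⟨u, J v⟩` and `β(u, v) = b(u, J v)`. -/
def kahlerOf (J : V → V) (b : V → V → ℝ) (x y z w : V) : ℝ :=
  let g : V → V → ℝ := fun u v ↦ inner ℝ u v
  let om : V → V → ℝ := fun u v ↦ inner ℝ u (J v)
  let β : V → V → ℝ := fun u v ↦ b u (J v)
  g x z * b y w + b x z * g y w - g y z * b x w - b y z * g x w
    + om x z * β y w + β x z * om y w - om y z * β x w - β y z * om x w
    + 2 * om x y * β z w + 2 * β x y * om z w

end Algebra

end SAH

end

/-! The curvature of the Levi-Civita connection is computed from `∇ = ∇̄ - ξ - η`, that is, as the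
curvature of `∇̄` corrected by `∇̃ξ`, by products of `ξ` and by `dη̂ ⊗ J`. Since the curvature of
`∇̄` takes values in `su(n)`, the part of the curvature of `∇` that anticommutes with `J`, and its
trace against `J`, only involve the torsion: the first gives `Ric - Ric*`, and the second gives
`2 Ric*` by the Bianchi identity.

In the Hermitian vector space `TₓM`, the map `Φ` is, up to the factor `4`, the adjoint of
`R ↦ 3 Ric*_H + Ric_H`. A Kähler curvature tensor has values in `su(n)` exactly if its Ricci form
vanishes, so the orthogonal complement of such tensors in `𝒦` is the image of `Φ`, on which
`3 Ric*_H + Ric_H` is injective. The projections of `R` are read off from this. -/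

noncomputable section

namespace SAH

section Multilinear

variable {V : Type*} [AddCommGroup V] [Module ℝ V] {f g : V → ℝ} {b : V → V → ℝ}

theorem isBilinearMap_of (h₁ : ∀ v, IsLinearMap ℝ fun u ↦ b u v)
    (h₂ : ∀ u, IsLinearMap ℝ (b u)) : IsBilinearMap ℝ b where
  add_left u u' v := (h₁ v).map_add u u'
  smul_left t u v := (h₁ v).map_smul t u
  add_right u v v' := (h₂ u).map_add v v'
  smul_right t u v := (h₂ u).map_smul t v

theorem isLinearMap_left (hb : IsBilinearMap ℝ b) (v : V) : IsLinearMap ℝ fun u ↦ b u v :=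
  ⟨fun _ _ ↦ hb.add_left _ _ _, fun _ _ ↦ hb.smul_left _ _ _⟩

theorem isLinearMap_right (hb : IsBilinearMap ℝ b) (u : V) : IsLinearMap ℝ (b u) :=
  ⟨fun _ _ ↦ hb.add_right _ _ _, fun _ _ ↦ hb.smul_right _ _ _⟩

theorem isLinearMap_comp [TopologicalSpace V] {W : Type*} [AddCommGroup W] [Module ℝ W]
    {f : V → W} (hf : IsLinearMap ℝ f) (A : V →L[ℝ] V) :
    IsLinearMap ℝ fun v ↦ f (A v) :=
  ⟨fun u v ↦ by rw [map_add, hf.map_add], fun t u ↦ by rw [map_smul, hf.map_smul]⟩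

theorem isLinearMap_const_mul (hf : IsLinearMap ℝ f) (c : ℝ) : IsLinearMap ℝ fun v ↦ c * f v :=
  (c • hf.mk' f).isLinear

theorem isLinearMap_mul_const (hf : IsLinearMap ℝ f) (c : ℝ) : IsLinearMap ℝ fun v ↦ f v * c := by
  simpa only [mul_comm c] using isLinearMap_const_mul hf c

theorem isLinearMap_neg (hf : IsLinearMap ℝ f) : IsLinearMap ℝ fun v ↦ -f v :=
  (-hf.mk' f).isLinear

theorem isLinearMap_sum {ι : Type*} [Fintype ι] {f : ι → V → ℝ} (hf : ∀ i, IsLinearMap ℝ (f i)) :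
    IsLinearMap ℝ fun v ↦ ∑ i, f i v :=
  ⟨fun u v ↦ by simp only [(hf _).map_add, Finset.sum_add_distrib],
    fun t u ↦ by simp only [(hf _).map_smul, Finset.smul_sum]⟩

theorem isBilinearMap_mul (hf : IsLinearMap ℝ f) (hg : IsLinearMap ℝ g) :
    IsBilinearMap ℝ fun u v ↦ f u * g v :=
  isBilinearMap_of (fun _ ↦ isLinearMap_mul_const hf _) fun _ ↦ isLinearMap_const_mul hg _

end Multilinear

section OrthonormalBasis

variable {V : Type*} [NormedAddCommGroup V] [InnerProductSpace ℝ V] {ι : Type*} [Fintype ι]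
  {f : V → ℝ}

theorem isBilinearMap_inner : IsBilinearMap ℝ fun u v : V ↦ (inner ℝ u v : ℝ) where
  add_left := inner_add_left
  smul_left t u v := real_inner_smul_left u v t
  add_right := inner_add_right
  smul_right t u v := real_inner_smul_right u v t

theorem sum_inner_basis_mul (e : OrthonormalBasis ι ℝ V) (hf : IsLinearMap ℝ f) (v : V) :
    ∑ i, inner ℝ (e i) v * f (e i) = f v := by
  conv_rhs => rw [← e.sum_repr' v]
  rw [show f = hf.mk' f from rfl, map_sum]
  simp only [map_smul, smul_eq_mul]

theorem sum_inner_basis_mul' (e : OrthonormalBasis ι ℝ V) (hf : IsLinearMap ℝ f) (v : V) :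
    ∑ i, inner ℝ v (e i) * f (e i) = f v := by
  simp only [real_inner_comm (e _) v]
  exact sum_inner_basis_mul e hf v

theorem eq_zero_of_basis (e : OrthonormalBasis ι ℝ V) (hf : IsLinearMap ℝ f)
    (h : ∀ i, f (e i) = 0) (v : V) : f v = 0 := by
  simp only [← sum_inner_basis_mul e hf v, h, mul_zero, Finset.sum_const_zero]

theorem sum_basis_eq {κ : Type*} [Fintype κ] {b : V → V → ℝ} (hb : IsBilinearMap ℝ b)
    (e : OrthonormalBasis ι ℝ V) (e' : OrthonormalBasis κ ℝ V) :
    ∑ i, b (e i) (e i) = ∑ i, b (e' i) (e' i) :=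
  calc ∑ i, b (e i) (e i) = ∑ i, ∑ j, inner ℝ (e i) (e' j) * b (e' j) (e i) :=
        Finset.sum_congr rfl fun _ _ ↦ (sum_inner_basis_mul' e' (isLinearMap_left hb _) _).symm
    _ = ∑ j, ∑ i, inner ℝ (e i) (e' j) * b (e' j) (e i) := Finset.sum_comm
    _ = ∑ j, b (e' j) (e' j) :=
        Finset.sum_congr rfl fun _ _ ↦ sum_inner_basis_mul e (isLinearMap_right hb _) _

end OrthonormalBasis

/-- An orthogonal complex structure on a real inner product space. -/
structure IsOrthComplex {V : Type*} [NormedAddCommGroup V] [InnerProductSpace ℝ V]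
    (J : V →L[ℝ] V) : Prop where
  sq : ∀ v, J (J v) = -v
  inner_map : ∀ v w, inner ℝ (J v) (J w) = inner ℝ v w

namespace IsOrthComplex

variable {V : Type*} [NormedAddCommGroup V] [InnerProductSpace ℝ V] {ι : Type*} [Fintype ι]
  {J : V →L[ℝ] V}

/-- An orthogonal complex structure as a linear isometry. -/
def isometry (hJ : IsOrthComplex J) : V ≃ₗᵢ[ℝ] V where
  toFun := J
  invFun := fun v ↦ -J v
  left_inv v := by simp [hJ.sq]
  right_inv v := by simp [hJ.sq]
  map_add' := map_add J
  map_smul' := map_smul J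
  norm_map' v := by
    simp only [LinearEquiv.coe_mk, LinearMap.coe_mk, AddHom.coe_mk]
    rw [@norm_eq_sqrt_real_inner V, @norm_eq_sqrt_real_inner V, hJ.inner_map]

theorem isometry_apply (hJ : IsOrthComplex J) (v : V) : hJ.isometry v = J v := rfl

theorem inner_right (hJ : IsOrthComplex J) (u v : V) : inner ℝ u (J v) = -inner ℝ (J u) v := by
  rw [← hJ.inner_map u (J v), hJ.sq, inner_neg_right]

theorem inner_swap (hJ : IsOrthComplex J) (u v : V) : inner ℝ u (J v) = -inner ℝ v (J u) := by
  rw [hJ.inner_right, real_inner_comm]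

theorem inner_self (hJ : IsOrthComplex J) (u : V) : inner ℝ u (J u) = 0 :=
  self_eq_neg.mp (hJ.inner_swap u u)

theorem sum_basis (hJ : IsOrthComplex J) (e : OrthonormalBasis ι ℝ V) {b : V → V → ℝ}
    (hb : IsBilinearMap ℝ b) : ∑ i, b (J (e i)) (J (e i)) = ∑ i, b (e i) (e i) := by
  rw [sum_basis_eq hb e (e.map hJ.isometry)]
  rfl

theorem sum_comp_mul (hJ : IsOrthComplex J) (e : OrthonormalBasis ι ℝ V) {f g : V → ℝ}
    (hf : IsLinearMap ℝ f) (hg : IsLinearMap ℝ g) :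
    ∑ i, f (J (e i)) * g (e i) = -∑ i, f (e i) * g (J (e i)) := by
  rw [← hJ.sum_basis e (isBilinearMap_mul hf (isLinearMap_comp hg J))]
  simp only [hJ.sq, hg.map_neg, mul_neg, Finset.sum_neg_distrib, neg_neg]

theorem sum_comp₂_mul (hJ : IsOrthComplex J) (e : OrthonormalBasis ι ℝ V) {f g : V → V → ℝ}
    (hf : IsBilinearMap ℝ f) (hg : IsBilinearMap ℝ g) :
    ∑ i, ∑ j, f (J (e i)) (J (e j)) * g (e i) (e j) =
      ∑ i, ∑ j, f (e i) (e j) * g (J (e i)) (J (e j)) := by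
  simp only [hJ.sum_comp_mul e (isLinearMap_right hf _) (isLinearMap_right hg _),
    Finset.sum_neg_distrib]
  rw [Finset.sum_comm]
  simp only [hJ.sum_comp_mul e (isLinearMap_left hf _) (isLinearMap_left hg _),
    Finset.sum_neg_distrib, neg_neg]
  exact Finset.sum_comm

end IsOrthComplex

namespace IsCurvature

variable {V : Type*} [NormedAddCommGroup V] [InnerProductSpace ℝ V] {R S : V → V → V → V → ℝ}

theorem lin₁ (hR : IsCurvature R) (b c d : V) : IsLinearMap ℝ fun a ↦ R a b c d :=
  ⟨fun _ _ ↦ hR.add _ _ _ _ _, fun _ _ ↦ hR.smul _ _ _ _ _⟩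

theorem lin₂ (hR : IsCurvature R) (a c d : V) : IsLinearMap ℝ fun b ↦ R a b c d := by
  simp only [fun b ↦ hR.antisymm b a c d]
  exact isLinearMap_neg (hR.lin₁ _ _ _)

theorem lin₃ (hR : IsCurvature R) (a b d : V) : IsLinearMap ℝ fun c ↦ R a b c d := by
  simp only [fun c ↦ (hR.pair_symm a b c d).symm]
  exact hR.lin₁ _ _ _

theorem lin₄ (hR : IsCurvature R) (a b c : V) : IsLinearMap ℝ fun d ↦ R a b c d := by
  simp only [fun d ↦ (hR.pair_symm a b c d).symm]
  exact hR.lin₂ _ _ _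

theorem antisymm' (hR : IsCurvature R) (a b c d : V) : R a b d c = -R a b c d := by
  rw [← hR.pair_symm, hR.antisymm, hR.pair_symm]

theorem flip (hR : IsCurvature R) (a b c d : V) : R b a d c = R a b c d := by
  rw [hR.antisymm, hR.antisymm', neg_neg]

theorem sub (hR : IsCurvature R) (hS : IsCurvature S) :
    IsCurvature fun a b c d ↦ R a b c d - S a b c d where
  add a a' b c d := by rw [hR.add, hS.add]; ring
  smul s a b c d := by rw [hR.smul, hS.smul]; ring
  antisymm a b c d := by rw [hR.antisymm, hS.antisymm]; ring
  pair_symm a b c d := by rw [hR.pair_symm, hS.pair_symm]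
  bianchi a b c d := by linear_combination hR.bianchi a b c d - hS.bianchi a b c d

theorem const_mul (hR : IsCurvature R) (t : ℝ) : IsCurvature fun a b c d ↦ t * R a b c d where
  add a a' b c d := by rw [hR.add]; ring
  smul s a b c d := by rw [hR.smul]; ring
  antisymm a b c d := by rw [hR.antisymm]; ring
  pair_symm a b c d := by rw [hR.pair_symm]
  bianchi a b c d := by linear_combination t * hR.bianchi a b c d

end IsCurvature

section Ricci

variable {V : Type*} [NormedAddCommGroup V] [InnerProductSpace ℝ V] {ι : Type*} [Fintype ι]

/-- The Ricci contraction of a four-tensor, with the sign and index conventions of `ric`. -/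
def ricciOf (e : OrthonormalBasis ι ℝ V) (R : V → V → V → V → ℝ) (u v : V) : ℝ :=
  ∑ i, R u (e i) v (e i)

/-- The `*`-Ricci contraction of a four-tensor, with the conventions of `ricStar`. -/
def ricciStarOf (J : V → V) (e : OrthonormalBasis ι ℝ V) (R : V → V → V → V → ℝ)
    (u v : V) : ℝ :=
  ∑ i, R u (e i) (J v) (J (e i))

theorem ricciOf_sub (e : OrthonormalBasis ι ℝ V) (R S : V → V → V → V → ℝ) (u v : V) :
    ricciOf e (fun a b c d ↦ R a b c d - S a b c d) u v = ricciOf e R u v - ricciOf e S u v :=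
  Finset.sum_sub_distrib _ _

namespace IsCurvature

variable {J : V →L[ℝ] V} {R : V → V → V → V → ℝ} (e : OrthonormalBasis ι ℝ V)

theorem eq_zero (hR : IsCurvature R) (h : ∀ i j k l, R (e i) (e j) (e k) (e l) = 0)
    (a b c d : V) : R a b c d = 0 :=
  eq_zero_of_basis e (hR.lin₁ b c d) (fun i ↦ eq_zero_of_basis e (hR.lin₂ (e i) c d)
    (fun j ↦ eq_zero_of_basis e (hR.lin₃ (e i) (e j) d)
      (fun k ↦ eq_zero_of_basis e (hR.lin₄ (e i) (e j) (e k)) (h i j k) d) c) b) a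

theorem isBilinearMap_ricciOf (hR : IsCurvature R) : IsBilinearMap ℝ (ricciOf e R) :=
  isBilinearMap_of (fun _ ↦ isLinearMap_sum fun _ ↦ hR.lin₁ _ _ _)
    (fun _ ↦ isLinearMap_sum fun _ ↦ hR.lin₃ _ _ _)

theorem isBilinearMap_ricciStarOf (hR : IsCurvature R) : IsBilinearMap ℝ (ricciStarOf J e R) :=
  isBilinearMap_of (fun _ ↦ isLinearMap_sum fun _ ↦ hR.lin₁ _ _ _)
    (fun _ ↦ isLinearMap_sum fun _ ↦ isLinearMap_comp (hR.lin₃ _ _ _) J)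

theorem ricciOf_symm (hR : IsCurvature R) (u v : V) : ricciOf e R u v = ricciOf e R v u :=
  Finset.sum_congr rfl fun _ _ ↦ hR.pair_symm _ _ _ _

theorem ricciStarOf_eq (hR : IsCurvature R) (hJ : IsOrthComplex J) (u v : V) :
    ricciStarOf J e R u v = ∑ i, R u (J (e i)) (e i) (J v) := by
  rw [ricciStarOf, ← hJ.sum_basis e (b := fun a b ↦ R u a (J v) (J b))]
  · exact Finset.sum_congr rfl fun i _ ↦ by
      rw [hJ.sq, (hR.lin₄ _ _ _).map_neg, ← hR.antisymm']
  · exact isBilinearMap_of (fun _ ↦ hR.lin₂ _ _ _) (fun _ ↦ isLinearMap_comp (hR.lin₄ _ _ _) J)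

theorem ricciStarOf_J (hR : IsCurvature R) (hJ : IsOrthComplex J) (u v : V) :
    ricciStarOf J e R (J u) (J v) = ricciStarOf J e R v u := by
  rw [hR.ricciStarOf_eq e hJ, ricciStarOf]
  refine Finset.sum_congr rfl fun i _ ↦ ?_
  rw [hJ.sq, (hR.lin₄ _ _ _).map_neg, ← hR.antisymm', ← hR.pair_symm, hR.flip]

theorem two_ricciStarOf (hR : IsCurvature R) (hJ : IsOrthComplex J) (u v : V) :
    2 * ricciStarOf J e R u v = ∑ i, R u (J v) (e i) (J (e i)) := by
  have bianchi : ∀ i, R u (J v) (e i) (J (e i)) =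
      R u (e i) (J v) (J (e i)) + R u (J (e i)) (e i) (J v) := fun i ↦ by
    have := hR.bianchi u (e i) (J v) (J (e i))
    rw [hR.antisymm u (J v), hR.pair_symm u (J (e i))] at this
    linarith
  simp only [bianchi, Finset.sum_add_distrib, ← hR.ricciStarOf_eq e hJ, two_mul]
  rfl

end IsCurvature

end Ricci

/-- Symmetric bilinear forms of type `(1, 1)`, that is, the real parts of Hermitian forms. -/
structure IsHermForm {V : Type*} [NormedAddCommGroup V] [InnerProductSpace ℝ V] (J : V → V)
    (b : V → V → ℝ) : Prop extends IsBilinearMap ℝ b where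
  symm : ∀ u v, b u v = b v u
  herm : ∀ u v, b (J u) (J v) = b u v

section HermForm

variable {V : Type*} [NormedAddCommGroup V] [InnerProductSpace ℝ V] {J : V →L[ℝ] V}
  {b b' : V → V → ℝ}

theorem isHermForm_inner (hJ : IsOrthComplex J) :
    IsHermForm J fun u v : V ↦ (inner ℝ u v : ℝ) where
  toIsBilinearMap := isBilinearMap_inner
  symm _ _ := real_inner_comm _ _
  herm := hJ.inner_map

namespace IsHermForm

theorem apply_J_left (hb : IsHermForm J b) (hJ : IsOrthComplex J) (u v : V) :
    b (J u) v = -b u (J v) := by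
  rw [← hb.herm, hJ.sq, (isLinearMap_left hb.toIsBilinearMap _).map_neg]

theorem apply_J_swap (hb : IsHermForm J b) (hJ : IsOrthComplex J) (u v : V) :
    b u (J v) = -b v (J u) := by
  rw [hb.symm, hb.apply_J_left hJ]

theorem apply_J_self (hb : IsHermForm J b) (hJ : IsOrthComplex J) (v : V) : b v (J v) = 0 :=
  self_eq_neg.mp (hb.apply_J_swap hJ v v)

theorem add (hb : IsHermForm J b) (hb' : IsHermForm J b') :
    IsHermForm J fun u v ↦ b u v + b' u v where
  add_left u u' v := by rw [hb.add_left, hb'.add_left]; ring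
  smul_left c u v := by rw [hb.smul_left, hb'.smul_left, smul_add]
  add_right u u' v := by rw [hb.add_right, hb'.add_right]; ring
  smul_right c u v := by rw [hb.smul_right, hb'.smul_right, smul_add]
  symm u v := by rw [hb.symm, hb'.symm]
  herm u v := by rw [hb.herm, hb'.herm]

theorem const_mul (hb : IsHermForm J b) (t : ℝ) : IsHermForm J fun u v ↦ t * b u v where
  add_left u u' v := by rw [hb.add_left, mul_add]
  smul_left c u v := by rw [hb.smul_left, smul_eq_mul, smul_eq_mul, mul_left_comm]
  add_right u u' v := by rw [hb.add_right, mul_add]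
  smul_right c u v := by rw [hb.smul_right, smul_eq_mul, smul_eq_mul, mul_left_comm]
  symm u v := by rw [hb.symm]
  herm u v := by rw [hb.herm]

theorem sub (hb : IsHermForm J b) (hb' : IsHermForm J b') :
    IsHermForm J fun u v ↦ b u v - b' u v := by
  simpa only [neg_one_mul, sub_eq_add_neg] using hb.add (hb'.const_mul (-1))

end IsHermForm

theorem kahlerOf_const_mul (J : V → V) (b : V → V → ℝ) (t : ℝ) (x y z w : V) :
    kahlerOf J (fun u v ↦ t * b u v) x y z w = t * kahlerOf J b x y z w := by
  simp only [kahlerOf]; ring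

theorem isKahler_kahlerOf (hJ : IsOrthComplex J) (hb : IsHermForm J b) :
    IsKahler J (kahlerOf J b) where
  add a a' c d f := by
    simp only [kahlerOf, inner_add_left, hb.add_left]; ring
  smul t a c d f := by
    simp only [kahlerOf, real_inner_smul_left, hb.smul_left, smul_eq_mul]; ring
  antisymm x y z w := by
    simp only [kahlerOf]
    rw [hJ.inner_swap y x, hb.apply_J_swap hJ y x]
    ring
  pair_symm x y z w := by
    simp only [kahlerOf]
    rw [hJ.inner_swap z x, hJ.inner_swap w y, hJ.inner_swap w x, hJ.inner_swap z y,
      hb.apply_J_swap hJ z x, hb.apply_J_swap hJ w y, hb.apply_J_swap hJ w x,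
      hb.apply_J_swap hJ z y, hb.symm z x, hb.symm w y, hb.symm w x, hb.symm z y,
      real_inner_comm x z, real_inner_comm y w, real_inner_comm x w, real_inner_comm y z]
    ring
  bianchi x y z w := by
    simp only [kahlerOf]
    rw [hJ.inner_swap y x, hJ.inner_swap z y, hJ.inner_swap z x, hb.apply_J_swap hJ y x,
      hb.apply_J_swap hJ z y, hb.apply_J_swap hJ z x, hb.symm y x, hb.symm z y, hb.symm z x,
      real_inner_comm x y, real_inner_comm y z, real_inner_comm x z]
    ring
  commute x y z w := by
    have inner_J_J : ∀ u v : V, inner ℝ u (J (J v)) = -inner ℝ u v := fun u v ↦ by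
      rw [hJ.sq, inner_neg_right]
    have apply_J_J : ∀ u v, b u (J (J v)) = -b u v := fun u v ↦ by
      rw [hJ.sq, (isLinearMap_right hb.toIsBilinearMap _).map_neg]
    simp only [kahlerOf, inner_J_J, apply_J_J, hJ.inner_right z, hb.apply_J_left hJ]
    ring

end HermForm

section Pairing

variable {V : Type*} [NormedAddCommGroup V] [InnerProductSpace ℝ V] {n : ℕ}
  {R : V → V → V → V → ℝ} (e : OrthonormalBasis (Fin (2 * n)) ℝ V)

/-- The inner product of two bilinear forms. -/
def pair₂ (b b' : V → V → ℝ) : ℝ :=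
  ∑ i, ∑ j, b (e i) (e j) * b' (e i) (e j)

theorem pair₂_comm (b b' : V → V → ℝ) : pair₂ e b b' = pair₂ e b' b := by
  simp only [pair₂, mul_comm]

theorem pair₂_inner {b : V → V → ℝ} (hb : IsBilinearMap ℝ b) :
    pair₂ e (fun u v ↦ inner ℝ u v) b = tr e b :=
  Finset.sum_congr rfl fun _ _ ↦ sum_inner_basis_mul' e (isLinearMap_right hb _) _

theorem tr_sub (b b' : V → V → ℝ) : tr e (fun u v ↦ b u v - b' u v) = tr e b - tr e b' :=
  Finset.sum_sub_distrib ..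

theorem tr_const_mul (t : ℝ) (b : V → V → ℝ) : tr e (fun u v ↦ t * b u v) = t * tr e b :=
  (Finset.mul_sum ..).symm

theorem tr_inner : tr e (fun u v ↦ inner ℝ u v) = 2 * n := by
  simp only [tr, real_inner_self_eq_norm_sq, e.norm_eq_one, one_pow, Finset.sum_const,
    Finset.card_univ, Fintype.card_fin, nsmul_eq_mul, mul_one, Nat.cast_mul, Nat.cast_ofNat]

theorem pair_comm (K L : V → V → V → V → ℝ) : pair e K L = pair e L K := by
  simp only [pair, mul_comm]

theorem pair_add_right (R K L : V → V → V → V → ℝ) :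
    pair e R (fun a b c d ↦ K a b c d + L a b c d) = pair e R K + pair e R L := by
  simp only [pair, mul_add, Finset.sum_add_distrib]

theorem pair_sub_right (R K L : V → V → V → V → ℝ) :
    pair e R (fun a b c d ↦ K a b c d - L a b c d) = pair e R K - pair e R L := by
  simp only [pair, mul_sub, Finset.sum_sub_distrib]

theorem pair_const_mul_right (R K : V → V → V → V → ℝ) (t : ℝ) :
    pair e R (fun a b c d ↦ t * K a b c d) = t * pair e R K := by
  simp only [pair, Finset.mul_sum, mul_left_comm]

theorem pair_sub_left (R K L : V → V → V → V → ℝ) :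
    pair e (fun a b c d ↦ R a b c d - K a b c d) L = pair e R L - pair e K L := by
  rw [pair_comm, pair_sub_right, pair_comm e L, pair_comm e L]

theorem pair_const_mul_left (R K : V → V → V → V → ℝ) (t : ℝ) :
    pair e (fun a b c d ↦ t * R a b c d) K = t * pair e R K := by
  rw [pair_comm, pair_const_mul_right, pair_comm]

theorem eq_zero_of_pair_self (h : pair e R R = 0) (i j k l : Fin (2 * n)) :
    R (e i) (e j) (e k) (e l) = 0 := by
  have sum_eq : ∑ p : Fin (2 * n) × Fin (2 * n) × Fin (2 * n) × Fin (2 * n),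
      R (e p.1) (e p.2.1) (e p.2.2.1) (e p.2.2.2) * R (e p.1) (e p.2.1) (e p.2.2.1) (e p.2.2.2)
        = 0 := by
    simpa only [Fintype.sum_prod_type, pair] using h
  exact mul_self_eq_zero.mp (congrFun
    ((Fintype.sum_eq_zero_iff_of_nonneg fun _ ↦ mul_self_nonneg _).mp sum_eq) (i, j, k, l))

theorem pair_swap_first (hR : IsCurvature R) (L : V → V → V → V → ℝ) :
    pair e R (fun x y z w ↦ L y x z w) = -pair e R L := by
  simp only [pair, ← Finset.sum_neg_distrib, ← neg_mul, ← hR.antisymm]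
  exact Finset.sum_comm

theorem pair_swap_last (hR : IsCurvature R) (L : V → V → V → V → ℝ) :
    pair e R (fun x y z w ↦ L x y w z) = -pair e R L := by
  simp only [pair, ← Finset.sum_neg_distrib, ← neg_mul, ← hR.antisymm']
  exact Finset.sum_congr rfl fun _ _ ↦ Finset.sum_congr rfl fun _ _ ↦ Finset.sum_comm

theorem pair_swap_pairs (hR : IsCurvature R) (L : V → V → V → V → ℝ) :
    pair e R (fun x y z w ↦ L z w x y) = pair e R L := by
  have h : ∀ F : Fin (2 * n) → Fin (2 * n) → Fin (2 * n) → Fin (2 * n) → ℝ,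
      ∑ i, ∑ j, ∑ k, ∑ l, F i j k l = ∑ k, ∑ l, ∑ i, ∑ j, F i j k l := fun F ↦ by
    have := Finset.sum_comm (s := Finset.univ) (t := Finset.univ)
      (f := fun (p q : Fin (2 * n) × Fin (2 * n)) ↦ F p.1 p.2 q.1 q.2)
    simpa only [Fintype.sum_prod_type] using this
  rw [pair, pair, h]
  simp only [hR.pair_symm]

theorem pair_antisymmetrize (hR : IsCurvature R) (L : V → V → V → V → ℝ) :
    pair e R (fun x y z w ↦ L x y z w + L y x w z - L y x z w - L x y w z) = 4 * pair e R L := by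
  rw [pair_sub_right, pair_sub_right, pair_add_right,
    pair_swap_first e hR (fun x y w z ↦ L x y z w), pair_swap_last e hR L, pair_swap_first e hR L]
  ring

/-- By the Bianchi identity, `R x y z w` is the antisymmetrization of `R x z y w` in `x`, `y`. -/
theorem pair_of_antisymm (hR : IsCurvature R) {L : V → V → V → V → ℝ}
    (hL : ∀ x y z w, L y x z w = -L x y z w) :
    pair e R L = 2 * pair e R (fun x y z w ↦ L x z y w) := by
  have swap_middle : pair e R (fun x y z w ↦ L x z y w) = pair e (fun x y z w ↦ R x z y w) L :=
    Finset.sum_congr rfl fun _ _ ↦ Finset.sum_comm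
  have swap_first : pair e (fun x y z w ↦ R y z x w) L = -pair e (fun x y z w ↦ R x z y w) L := by
    simp only [pair, ← Finset.sum_neg_distrib, ← mul_neg, ← hL]
    exact Finset.sum_comm
  have bianchi : R = fun x y z w ↦ R x z y w - R y z x w := by
    funext x y z w
    linear_combination hR.bianchi x y z w - hR.antisymm x z y w
  conv_lhs => rw [bianchi]
  rw [pair_sub_left, swap_first, swap_middle]
  ring

theorem pair_comp_J {J : V →L[ℝ] V} (hJ : IsOrthComplex J) {F L : V → V → V → V → ℝ}
    (hF : ∀ x y, IsBilinearMap ℝ (F x y)) (hL : ∀ x y, IsBilinearMap ℝ (L x y)) :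
    pair e (fun x y z w ↦ F x y (J z) (J w)) L = pair e F (fun x y z w ↦ L x y (J z) (J w)) :=
  Finset.sum_congr rfl fun _ _ ↦ Finset.sum_congr rfl fun _ _ ↦ hJ.sum_comp₂_mul e (hF _ _) (hL _ _)

theorem pair_inner_mul {F : V → V → V → V → ℝ} (hF : ∀ x y w, IsLinearMap ℝ fun z ↦ F x y z w)
    (hflip : ∀ x y z w, F y x w z = F x y z w) (b : V → V → ℝ) :
    pair e F (fun x y z w ↦ inner ℝ x z * b y w) = pair₂ e (ricciOf e F) b := by
  have contract : ∀ i j l, ∑ k, F (e i) (e j) (e k) (e l) * (inner ℝ (e i) (e k) * b (e j) (e l)) =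
      F (e i) (e j) (e i) (e l) * b (e j) (e l) := fun i j l ↦ by
    rw [← sum_inner_basis_mul' e (hF (e i) (e j) (e l)) (e i), Finset.sum_mul]
    exact Finset.sum_congr rfl fun k _ ↦ by ring
  calc _ = ∑ i, ∑ j, ∑ l, F (e i) (e j) (e i) (e l) * b (e j) (e l) :=
        Finset.sum_congr rfl fun _ _ ↦ Finset.sum_congr rfl fun _ _ ↦
          Finset.sum_comm.trans (Finset.sum_congr rfl fun _ _ ↦ contract _ _ _)
    _ = ∑ j, ∑ l, ∑ i, F (e i) (e j) (e i) (e l) * b (e j) (e l) :=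
        Finset.sum_comm.trans (Finset.sum_congr rfl fun _ _ ↦ Finset.sum_comm)
    _ = pair₂ e (ricciOf e F) b := by
        simp only [pair₂, ricciOf, Finset.sum_mul, hflip]

variable {J : V →L[ℝ] V} {b : V → V → ℝ}

theorem pair_inner_J_mul (hJ : IsOrthComplex J) (hR : IsCurvature R) (hb : IsBilinearMap ℝ b) :
    pair e R (fun x y z w ↦ inner ℝ x (J z) * b y (J w)) = pair₂ e (ricciStarOf J e R) b := by
  rw [← pair_comp_J e hJ (F := R) (L := fun x y z w ↦ inner ℝ x z * b y w)
    (fun _ _ ↦ isBilinearMap_of (fun _ ↦ hR.lin₃ _ _ _) fun _ ↦ hR.lin₄ _ _ _)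
    fun _ _ ↦ isBilinearMap_mul (isLinearMap_right isBilinearMap_inner _) (isLinearMap_right hb _)]
  exact pair_inner_mul e (F := fun x y z w ↦ R x y (J z) (J w))
    (fun x y w ↦ isLinearMap_comp (hR.lin₃ x y (J w)) J) (fun x y _ _ ↦ hR.flip x y _ _) b

theorem pair_kahlerOf (hJ : IsOrthComplex J) (hR : IsCurvature R) (hb : IsBilinearMap ℝ b) :
    pair e R (kahlerOf J b) =
      4 * pair₂ e (ricciOf e R) b + 12 * pair₂ e (ricciStarOf J e R) b := by
  set G : V → V → V → V → ℝ := fun x y z w ↦ inner ℝ x z * b y w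
  set Ω : V → V → V → V → ℝ := fun x y z w ↦ inner ℝ x (J z) * b y (J w)
  set Θ : V → V → V → V → ℝ := fun x y z w ↦ inner ℝ x (J y) * b z (J w)
  have kahlerOf_eq : kahlerOf J b = fun x y z w ↦
      (G x y z w + G y x w z - G y x z w - G x y w z) +
      (Ω x y z w + Ω y x w z - Ω y x z w - Ω x y w z) + 2 * Θ x y z w + 2 * Θ z w x y := by
    funext x y z w
    simp only [kahlerOf, G, Ω, Θ]; ring
  have hΘ : pair e R Θ = 2 * pair e R Ω :=
    pair_of_antisymm e hR fun x y z w ↦ by simp only [Θ, hJ.inner_swap y x]; ring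
  rw [kahlerOf_eq, pair_add_right, pair_add_right, pair_add_right, pair_antisymmetrize e hR,
    pair_antisymmetrize e hR, pair_const_mul_right, pair_const_mul_right,
    pair_swap_pairs e hR Θ, hΘ, pair_inner_J_mul e hJ hR hb,
    pair_inner_mul e (fun x y w ↦ hR.lin₃ x y w) hR.flip]
  ring

theorem ricciOf_kahlerOf (hJ : IsOrthComplex J) (hb : IsHermForm J b) (u v : V) :
    ricciOf e (kahlerOf J b) u v = tr e b * inner ℝ u v + (2 * n + 4) * b u v := by
  have diagonal : ∀ x : V, kahlerOf J b u x v x =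
      inner ℝ u v * b x x + b u v * inner ℝ x x
      - inner ℝ x v * b u x - inner ℝ u x * b x v
      + inner ℝ x (J v) * b (J u) x + inner ℝ (J u) x * b x (J v)
      + 2 * (inner ℝ (J u) x * b (J v) x) + 2 * (inner ℝ (J v) x * b (J u) x) := fun x ↦ by
    simp only [kahlerOf, hJ.inner_self, hb.apply_J_self hJ, hb.apply_J_left hJ,
      hJ.inner_right u x, hJ.inner_right v x]
    ring
  have hl := isLinearMap_left hb.toIsBilinearMap
  have hr := isLinearMap_right hb.toIsBilinearMap
  simp only [ricciOf, diagonal, Finset.sum_add_distrib, Finset.sum_sub_distrib, ← Finset.mul_sum]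
  rw [sum_inner_basis_mul e (hr u), sum_inner_basis_mul' e (hl v), sum_inner_basis_mul e (hr (J u)),
    sum_inner_basis_mul' e (hl (J v)), sum_inner_basis_mul' e (hr (J v)),
    sum_inner_basis_mul' e (hr (J u)), hb.herm, hb.herm, hb.symm v u]
  change _ * tr e b + _ * tr e (fun x y ↦ inner ℝ x y) - _ - _ + _ + _ + _ + _ = _
  rw [tr_inner]
  ring

end Pairing

section KahlerCurvature

variable {V : Type*} [NormedAddCommGroup V] [InnerProductSpace ℝ V] {n : ℕ}
  {J : V →L[ℝ] V} {K L : V → V → V → V → ℝ} {b : V → V → ℝ}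
  (e : OrthonormalBasis (Fin (2 * n)) ℝ V)

namespace IsKahler

theorem sub (hK : IsKahler J K) (hL : IsKahler J L) :
    IsKahler J fun a b c d ↦ K a b c d - L a b c d where
  toIsCurvature := hK.toIsCurvature.sub hL.toIsCurvature
  commute a b c d := by rw [hK.commute, hL.commute]

theorem const_mul (hK : IsKahler J K) (t : ℝ) : IsKahler J fun a b c d ↦ t * K a b c d where
  toIsCurvature := hK.toIsCurvature.const_mul t
  commute a b c d := by rw [hK.commute]

theorem ricciStarOf_eq_ricciOf (hK : IsKahler J K) : ricciStarOf J e K = ricciOf e K := by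
  funext u v
  exact Finset.sum_congr rfl fun _ _ ↦ hK.commute _ _ _ _

theorem isHermForm_ricciOf (hJ : IsOrthComplex J) (hK : IsKahler J K) :
    IsHermForm J (ricciOf e K) where
  toIsBilinearMap := hK.isBilinearMap_ricciOf e
  symm := hK.ricciOf_symm e
  herm u v := by
    rw [← hK.ricciStarOf_eq_ricciOf, hK.ricciStarOf_J e hJ, hK.ricciStarOf_eq_ricciOf,
      hK.ricciOf_symm]

theorem pair_kahlerOf (hJ : IsOrthComplex J) (hK : IsKahler J K) (hb : IsBilinearMap ℝ b) :
    pair e K (kahlerOf J b) = 16 * pair₂ e (ricciOf e K) b := by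
  rw [SAH.pair_kahlerOf e hJ hK.toIsCurvature hb, hK.ricciStarOf_eq_ricciOf]
  ring

theorem isCurSU_iff (hJ : IsOrthComplex J) (hK : IsKahler J K) :
    IsCurSU J e K ↔ ∀ u v, ricciOf e K u v = 0 := by
  have trace_eq : ∀ u v, ∑ i, K u (J v) (e i) (J (e i)) = 2 * ricciOf e K u v := fun u v ↦ by
    rw [← hK.two_ricciStarOf e hJ, hK.ricciStarOf_eq_ricciOf]
  refine ⟨fun hSU u v ↦ ?_, fun h ↦ ⟨hK, fun u v ↦ ?_⟩⟩
  · have := trace_eq u v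
    rw [hSU.traceless] at this
    linarith
  · have := trace_eq u (-J v)
    rwa [h, map_neg, hJ.sq, neg_neg, mul_zero] at this

/-- The difference of the two tensors is `su(n)`-valued, hence orthogonal to itself. -/
theorem eq_of_ricciOf_eq (hJ : IsOrthComplex J) (hK : IsKahler J K) (hL : IsKahler J L)
    (hK_perp : ∀ B, IsCurSU J e B → pair e K B = 0) (hL_perp : ∀ B, IsCurSU J e B → pair e L B = 0)
    (h : ∀ u v, ricciOf e K u v = ricciOf e L u v) : K = L := by
  have hKL := hK.sub hL
  have hSU := (hKL.isCurSU_iff e hJ).mpr fun u v ↦ by rw [ricciOf_sub, h, sub_self]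
  have orthogonal_self : pair e (fun a b c d ↦ K a b c d - L a b c d)
      (fun a b c d ↦ K a b c d - L a b c d) = 0 := by
    rw [pair_sub_left, hK_perp _ hSU, hL_perp _ hSU, sub_zero]
  funext x y z w
  exact sub_eq_zero.mp (hKL.eq_zero e (eq_zero_of_pair_self e orthogonal_self) x y z w)

end IsKahler

theorem IsCurSU.pair_kahlerOf_left (hJ : IsOrthComplex J) (hK : IsCurSU J e K)
    (hb : IsBilinearMap ℝ b) : pair e (kahlerOf J b) K = 0 := by
  rw [pair_comm, hK.toIsKahler.pair_kahlerOf e hJ hb]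
  simp only [pair₂, (hK.toIsKahler.isCurSU_iff e hJ).mp hK, zero_mul, Finset.sum_const_zero,
    mul_zero]

end KahlerCurvature

section Schur

variable {V : Type*} [NormedAddCommGroup V] [InnerProductSpace ℝ V] {J : V →L[ℝ] V}
  {b : V → V → ℝ}

/-- The complex line spanned by a vector `a`, as a real subspace. -/
def complexLine (J : V → V) (a : V) : Submodule ℝ V :=
  Submodule.span ℝ {a, J a}

instance (J : V → V) (a : V) : FiniteDimensional ℝ (complexLine J a) :=
  FiniteDimensional.span_of_finite ℝ (by simp)

theorem self_mem_complexLine (J : V → V) (a : V) : a ∈ complexLine J a :=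
  Submodule.subset_span (by simp)

theorem apply_mem_complexLine (J : V → V) (a : V) : J a ∈ complexLine J a :=
  Submodule.subset_span (by simp)

theorem IsOrthComplex.map_complexLine (hJ : IsOrthComplex J) (a : V) :
    (complexLine J a).map (hJ.isometry.toLinearEquiv : V →ₗ[ℝ] V) = complexLine J a := by
  refine le_antisymm (Submodule.map_le_iff_le_comap.mpr (Submodule.span_le.mpr ?_))
    (Submodule.span_le.mpr ?_)
  · rintro v (rfl | rfl)
    · exact apply_mem_complexLine J v
    · change J (J a) ∈ complexLine J a
      rw [hJ.sq]
      exact neg_mem (self_mem_complexLine J a)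
  · rintro v (rfl | rfl)
    · exact ⟨-J v, neg_mem (apply_mem_complexLine J v), by
        simp [hJ.isometry_apply, hJ.sq]⟩
    · exact ⟨a, self_mem_complexLine J a, rfl⟩

theorem IsOrthComplex.reflection_complexLine_apply (hJ : IsOrthComplex J) (a v : V) :
    (complexLine J a).reflection (J v) = J ((complexLine J a).reflection v) := by
  have h := Submodule.reflection_map_apply hJ.isometry (complexLine J a) (J v)
  simp only [hJ.map_complexLine] at h
  rw [h, ← hJ.isometry_apply v, hJ.isometry.symm_apply_apply, hJ.isometry_apply]

/-- The reflection in the complex line of `a` fixes `a` and negates the orthogonal complement of the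
line, so invariance makes the two `b`-orthogonal. -/
theorem IsHermForm.apply_mul_inner_self_of_invariant (hJ : IsOrthComplex J) (hb : IsHermForm J b)
    (h : ∀ g : V ≃ₗᵢ[ℝ] V, (∀ v, g (J v) = J (g v)) → ∀ u v, b (g u) (g v) = b u v) (a v : V) :
    b a v * inner ℝ a a = b a a * inner ℝ a v := by
  obtain ⟨y, hy, z, hz, rfl⟩ := (complexLine J a).exists_add_mem_mem_orthogonal v
  obtain ⟨s, t, rfl⟩ := Submodule.mem_span_pair.mp hy
  have b_eq_zero : b a z = 0 := by
    have := h (complexLine J a).reflection (hJ.reflection_complexLine_apply a) a z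
    rw [Submodule.reflection_mem_subspace_eq_self (self_mem_complexLine J a),
      Submodule.reflection_mem_subspace_orthogonalComplement_eq_neg hz,
      (isLinearMap_right hb.toIsBilinearMap a).map_neg] at this
    linarith
  have inner_eq_zero : inner ℝ a z = 0 := hz a (self_mem_complexLine J a)
  simp only [hb.add_right, hb.smul_right, hb.apply_J_self hJ, b_eq_zero, inner_add_right,
    real_inner_smul_right, hJ.inner_self, inner_eq_zero, smul_eq_mul]
  ring

theorem IsHermForm.exists_eq_mul_inner (hJ : IsOrthComplex J) (hb : IsHermForm J b)
    (h : ∀ g : V ≃ₗᵢ[ℝ] V, (∀ v, g (J v) = J (g v)) → ∀ u v, b (g u) (g v) = b u v) :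
    ∃ t : ℝ, ∀ u v, b u v = t * inner ℝ u v := by
  have proportional := hb.apply_mul_inner_self_of_invariant hJ h
  rcases subsingleton_or_nontrivial V with hV | hV
  · exact ⟨0, fun u v ↦ by
      rw [Subsingleton.elim u 0, (isLinearMap_left hb.toIsBilinearMap v).map_zero, zero_mul]⟩
  obtain ⟨a, ha⟩ := exists_ne (0 : V)
  have haa : inner ℝ a a ≠ (0 : ℝ) := inner_self_ne_zero.mpr ha
  refine ⟨b a a / inner ℝ a a, fun u v ↦ ?_⟩
  have polar_add := proportional (a + u) v
  have polar_sub := proportional (a + (-1 : ℝ) • u) v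
  simp only [hb.add_left, hb.add_right, hb.smul_left, hb.smul_right, smul_eq_mul, inner_add_left,
    inner_add_right, real_inner_smul_left, real_inner_smul_right, real_inner_comm a u,
    hb.symm u a] at polar_add polar_sub
  rw [div_mul_eq_mul_div, eq_div_iff haa]
  refine mul_left_cancel₀ haa ?_
  linear_combination inner ℝ a a * ((polar_add - polar_sub) / 2 - proportional u v) -
    2 * inner ℝ a u * proportional a v + 2 * inner ℝ a v * proportional a u

end Schur

section Components

variable {V : Type*} [NormedAddCommGroup V] [InnerProductSpace ℝ V] {n : ℕ}
  {J : V →L[ℝ] V} {R K : V → V → V → V → ℝ} {b b' T : V → V → ℝ}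
  (e : OrthonormalBasis (Fin (2 * n)) ℝ V)

theorem pair_kahlerOf_kahlerOf (hJ : IsOrthComplex J) (hb : IsHermForm J b)
    (hb' : IsHermForm J b') : pair e (kahlerOf J b) (kahlerOf J b') =
      16 * (tr e b * tr e b' + (2 * n + 4) * pair₂ e b b') := by
  rw [(isKahler_kahlerOf hJ hb).pair_kahlerOf e hJ hb'.toIsBilinearMap,
    ← pair₂_inner e hb'.toIsBilinearMap]
  simp only [pair₂, ricciOf_kahlerOf e hJ hb, add_mul, Finset.sum_add_distrib, Finset.mul_sum,
    mul_assoc]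

theorem kahlerOf_inner_map (g : V ≃ₗᵢ[ℝ] V) (hg : ∀ v, g (J v) = J (g v)) (x y z w : V) :
    kahlerOf J (fun u v ↦ inner ℝ u v) (g x) (g y) (g z) (g w) =
      kahlerOf J (fun u v ↦ inner ℝ u v) x y z w := by
  simp only [kahlerOf, ← hg, LinearIsometryEquiv.inner_map_map]

theorem isK1_kahlerOf_inner (hJ : IsOrthComplex J) (t : ℝ) :
    IsK1 J e fun a b c d ↦ t * kahlerOf J (fun u v ↦ inner ℝ u v) a b c d where
  toIsKahler := (isKahler_kahlerOf hJ (isHermForm_inner hJ)).const_mul t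
  perp_su L hL := by
    rw [pair_const_mul_left, hL.pair_kahlerOf_left e hJ isBilinearMap_inner, mul_zero]
  invariant g hg a b c d := by rw [kahlerOf_inner_map g hg]

theorem IsK1.ricciOf_map (hK : IsK1 J e K) (g : V ≃ₗᵢ[ℝ] V) (hg : ∀ v, g (J v) = J (g v))
    (u v : V) : ricciOf e K (g u) (g v) = ricciOf e K u v := by
  have h : ∀ i, K (g u) (e i) (g v) (e i) = K u (g.symm (e i)) v (g.symm (e i)) := fun i ↦ by
    rw [← hK.invariant g hg u, g.apply_symm_apply]
  simp only [ricciOf, h]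
  exact sum_basis_eq (b := fun a c ↦ K u a v c)
    (isBilinearMap_of (fun _ ↦ hK.lin₂ _ _ _) (fun _ ↦ hK.lin₄ _ _ _)) (e.map g.symm) e

theorem IsK1.exists_eq (hJ : IsOrthComplex J) (hK : IsK1 J e K) :
    ∃ t : ℝ, K = fun a b c d ↦ t * kahlerOf J (fun u v ↦ inner ℝ u v) a b c d := by
  obtain ⟨c, hc⟩ := (hK.isHermForm_ricciOf e hJ).exists_eq_mul_inner hJ (hK.ricciOf_map e)
  have hΦ := isK1_kahlerOf_inner e hJ (c / (4 * n + 4))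
  refine ⟨c / (4 * n + 4), hK.eq_of_ricciOf_eq e hJ hΦ.toIsKahler hK.perp_su hΦ.perp_su
    fun u v ↦ ?_⟩
  rw [hc, ricciOf, ← Finset.mul_sum, ← ricciOf, ricciOf_kahlerOf e hJ (isHermForm_inner hJ),
    tr_inner]
  field_simp
  ring

theorem IsK2.tr_ricciOf (hJ : IsOrthComplex J) (hK : IsK2 J e K) : tr e (ricciOf e K) = 0 := by
  have h := hK.perp_K1 _ (isK1_kahlerOf_inner e hJ 1)
  rw [pair_const_mul_right, hK.pair_kahlerOf e hJ isBilinearMap_inner, pair₂_comm,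
    pair₂_inner e (hK.isBilinearMap_ricciOf e)] at h
  linarith

theorem isK2_kahlerOf (hJ : IsOrthComplex J) (hb : IsHermForm J b) (htr : tr e b = 0) :
    IsK2 J e (kahlerOf J b) where
  toIsKahler := isKahler_kahlerOf hJ hb
  perp_su L hL := hL.pair_kahlerOf_left e hJ hb.toIsBilinearMap
  perp_K1 L hL := by
    obtain ⟨t, rfl⟩ := hL.exists_eq e hJ
    rw [pair_const_mul_right, pair_kahlerOf_kahlerOf e hJ hb (isHermForm_inner hJ), htr,
      pair₂_comm, pair₂_inner e hb.toIsBilinearMap, htr]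
    ring

theorem IsK2.exists_eq (hJ : IsOrthComplex J) (hK : IsK2 J e K) :
    ∃ b, IsHermForm J b ∧ tr e b = 0 ∧ K = kahlerOf J b := by
  have hb := (hK.isHermForm_ricciOf e hJ).const_mul (2 * n + 4 : ℝ)⁻¹
  have htr : tr e (fun u v ↦ (2 * n + 4 : ℝ)⁻¹ * ricciOf e K u v) = 0 := by
    rw [tr_const_mul, hK.tr_ricciOf e hJ, mul_zero]
  have hΦ := isK2_kahlerOf e hJ hb htr
  refine ⟨_, hb, htr, hK.eq_of_ricciOf_eq e hJ hΦ.toIsKahler hK.perp_su hΦ.perp_su fun u v ↦ ?_⟩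
  rw [ricciOf_kahlerOf e hJ hb, htr]
  field_simp
  ring

theorem isHermForm_hermPart (hJ : IsOrthComplex J) (hb : IsBilinearMap ℝ b)
    (hsymm : ∀ u v, hermPart J b u v = hermPart J b v u) : IsHermForm J (hermPart J b) where
  add_left u u' v := by simp only [hermPart, map_add, hb.add_left]; ring
  smul_left t u v := by simp only [hermPart, map_smul, hb.smul_left, smul_eq_mul]; ring
  add_right u u' v := by simp only [hermPart, map_add, hb.add_right]; ring
  smul_right t u v := by simp only [hermPart, map_smul, hb.smul_right, smul_eq_mul]; ring
  symm := hsymm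
  herm u v := by
    simp only [hermPart, hJ.sq, (isLinearMap_left hb _).map_neg,
      (isLinearMap_right hb _).map_neg]
    ring

theorem pair₂_hermPart (hJ : IsOrthComplex J) (hb : IsBilinearMap ℝ b) (hb' : IsHermForm J b') :
    pair₂ e (hermPart J b) b' = pair₂ e b b' := by
  have h := hJ.sum_comp₂_mul e hb hb'.toIsBilinearMap
  simp only [hb'.herm] at h
  simp only [pair₂, hermPart, div_mul_eq_mul_div, add_mul, ← Finset.sum_div,
    Finset.sum_add_distrib, h]
  ring

theorem IsCurvature.isHermForm_three_ricciStarOf_add_ricciOf (hJ : IsOrthComplex J)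
    (hR : IsCurvature R) :
    IsHermForm J fun u v ↦
      3 * hermPart J (ricciStarOf J e R) u v + hermPart J (ricciOf e R) u v :=
  ((isHermForm_hermPart hJ (hR.isBilinearMap_ricciStarOf e) fun u v ↦ by
    rw [hermPart, hermPart, hR.ricciStarOf_J e hJ, hR.ricciStarOf_J e hJ, add_comm]).const_mul
      3).add (isHermForm_hermPart hJ (hR.isBilinearMap_ricciOf e) fun u v ↦ by
    rw [hermPart, hermPart, hR.ricciOf_symm, hR.ricciOf_symm e (J u)])

theorem IsCurvature.pair_kahlerOf_hermPart (hJ : IsOrthComplex J) (hR : IsCurvature R)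
    (hb : IsHermForm J b) : pair e R (kahlerOf J b) =
      4 * pair₂ e (fun u v ↦
        3 * hermPart J (ricciStarOf J e R) u v + hermPart J (ricciOf e R) u v) b := by
  rw [pair_kahlerOf e hJ hR hb.toIsBilinearMap,
    ← pair₂_hermPart e hJ (hR.isBilinearMap_ricciOf e) hb,
    ← pair₂_hermPart e hJ (hR.isBilinearMap_ricciStarOf e) hb]
  simp only [pair₂, add_mul, mul_assoc, Finset.sum_add_distrib, ← Finset.mul_sum]
  ring

theorem isComponent_K1 (hn : n ≠ 0) (hJ : IsOrthComplex J) (hT : IsHermForm J T)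
    (h : ∀ b, IsHermForm J b → pair e R (kahlerOf J b) = 4 * pair₂ e T b) :
    IsComponent e (IsK1 J e) R fun a b c d ↦ tr e T / (32 * n * (n + 1)) *
      kahlerOf J (fun u v ↦ inner ℝ u v) a b c d := by
  refine ⟨isK1_kahlerOf_inner e hJ _, fun B hB ↦ ?_⟩
  obtain ⟨t, rfl⟩ := hB.exists_eq e hJ
  have hg := isHermForm_inner hJ
  rw [pair_sub_left, pair_const_mul_left, pair_const_mul_right, pair_const_mul_right, h _ hg,
    pair_kahlerOf_kahlerOf e hJ hg hg, pair₂_inner e hg.toIsBilinearMap, pair₂_comm,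
    pair₂_inner e hT.toIsBilinearMap, tr_inner]
  have : (n : ℝ) ≠ 0 := Nat.cast_ne_zero.mpr hn
  field_simp
  ring

theorem isComponent_K2 (hn : n ≠ 0) (hJ : IsOrthComplex J) (hT : IsHermForm J T)
    (h : ∀ b, IsHermForm J b → pair e R (kahlerOf J b) = 4 * pair₂ e T b) :
    IsComponent e (IsK2 J e) R fun a b c d ↦ 1 / (8 * (n + 2)) *
      kahlerOf J (fun u v ↦ T u v - tr e T / (2 * n) * inner ℝ u v) a b c d := by
  have hg := isHermForm_inner hJ
  have hT₀ := hT.sub (hg.const_mul (tr e T / (2 * n)))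
  have htr : tr e (fun u v ↦ T u v - tr e T / (2 * n) * inner ℝ u v) = 0 := by
    rw [tr_sub, tr_const_mul, tr_inner]
    have : (n : ℝ) ≠ 0 := Nat.cast_ne_zero.mpr hn
    field_simp
    ring
  refine ⟨?_, fun B hB ↦ ?_⟩
  · simp only [← kahlerOf_const_mul]
    exact isK2_kahlerOf e hJ (hT₀.const_mul _) (by rw [tr_const_mul, htr, mul_zero])
  · obtain ⟨b, hb, hb₀, rfl⟩ := hB.exists_eq e hJ
    have pair_tracefree :
        pair₂ e (fun u v ↦ T u v - tr e T / (2 * n) * inner ℝ u v) b = pair₂ e T b := by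
      have h₀ := pair₂_inner e hb.toIsBilinearMap
      simp only [pair₂] at h₀
      simp only [pair₂, sub_mul, Finset.sum_sub_distrib, mul_assoc, ← Finset.mul_sum, h₀, hb₀,
        mul_zero, sub_zero]
    rw [pair_sub_left, pair_const_mul_left, h b hb, pair_kahlerOf_kahlerOf e hJ hT₀ hb, hb₀,
      pair_tracefree]
    field_simp
    ring

end Components

section ComplexLinearPart

variable {V : Type*} [NormedAddCommGroup V] [InnerProductSpace ℝ V] {J A B : V →L[ℝ] V}

/-- The part of an endomorphism that commutes with the complex structure `J`. -/
def complexLinearPart (J A : V →L[ℝ] V) : V →L[ℝ] V :=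
  (1 / 2 : ℝ) • (A - J ∘L A ∘L J)

theorem complexLinearPart_apply (J A : V →L[ℝ] V) (v : V) :
    complexLinearPart J A v = (1 / 2 : ℝ) • (A v - J (A (J v))) := rfl

theorem complexLinearPart_comm (hJ : IsOrthComplex J) (A : V →L[ℝ] V) (v : V) :
    complexLinearPart J A (J v) = J (complexLinearPart J A v) := by
  simp only [complexLinearPart_apply, hJ.sq, map_smul, map_sub, map_neg]
  module

theorem inner_complexLinearPart (hJ : IsOrthComplex J)
    (hA : ∀ v w, inner ℝ (A v) w = -inner ℝ v (A w)) (v w : V) :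
    inner ℝ (complexLinearPart J A v) w = -inner ℝ v (complexLinearPart J A w) := by
  have hJAJ : inner ℝ (J (A (J v))) w = -inner ℝ v (J (A (J w))) := by
    rw [← neg_eq_iff_eq_neg, ← hJ.inner_right, hA, hJ.inner_right]
  simp only [complexLinearPart_apply, real_inner_smul_left, real_inner_smul_right,
    inner_sub_left, inner_sub_right, hA v w, hJAJ]
  ring

theorem trace_complexLinearPart_comp (hJ : IsOrthComplex J) (hB : ∀ v, B (J v) = J (B v)) :
    LinearMap.trace ℝ V ((complexLinearPart J A ∘L B : V →L[ℝ] V) : V →ₗ[ℝ] V) =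
      LinearMap.trace ℝ V ((A ∘L B : V →L[ℝ] V) : V →ₗ[ℝ] V) := by
  let a : Module.End ℝ V := A
  let b : Module.End ℝ V := B
  let j : Module.End ℝ V := J
  have hjj : j * j = -1 := LinearMap.ext hJ.sq
  have hjb : j * b = b * j := LinearMap.ext fun v ↦ (hB v).symm
  have trace_jajb : LinearMap.trace ℝ V (j * a * j * b) = -LinearMap.trace ℝ V (a * b) :=
    calc LinearMap.trace ℝ V (j * a * j * b) = LinearMap.trace ℝ V (j * (a * b * j)) := by
          rw [mul_assoc _ j, hjb, mul_assoc, ← mul_assoc a]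
      _ = LinearMap.trace ℝ V (a * b * (j * j)) := by
          rw [LinearMap.trace_mul_comm, mul_assoc]
      _ = -LinearMap.trace ℝ V (a * b) := by rw [hjj, mul_neg, mul_one, map_neg]
  change LinearMap.trace ℝ V ((1 / 2 : ℝ) • (a - j * a * j) * b) = LinearMap.trace ℝ V (a * b)
  rw [smul_mul_assoc, sub_mul, map_smul, map_sub, trace_jajb, smul_eq_mul]
  ring

variable [FiniteDimensional ℝ V]

theorem eq_zero_of_trace_comp_self (hB : ∀ v w, inner ℝ (B v) w = -inner ℝ v (B w))
    (h : LinearMap.trace ℝ V ((B ∘L B : V →L[ℝ] V) : V →ₗ[ℝ] V) = 0) : B = 0 := by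
  let e := stdOrthonormalBasis ℝ V
  have sum_eq_zero : ∑ i, inner ℝ (B (e i)) (B (e i)) = (0 : ℝ) := by
    simp only [hB, Finset.sum_neg_distrib, neg_eq_zero]
    rwa [LinearMap.trace_eq_sum_inner _ e] at h
  rw [Finset.sum_eq_zero_iff_of_nonneg fun _ _ ↦ real_inner_self_nonneg] at sum_eq_zero
  have h₀ : (B : V →ₗ[ℝ] V) = 0 := e.toBasis.ext fun i ↦ by
    simpa using inner_self_eq_zero.mp (sum_eq_zero i (Finset.mem_univ i))
  exact ContinuousLinearMap.coe_injective h₀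

theorem complexLinearPart_eq_of_perp_su {n : ℕ} (hn : n ≠ 0) (hdim : Module.finrank ℝ V = 2 * n)
    (hJ : IsOrthComplex J) (hA : ∀ v w, inner ℝ (A v) w = -inner ℝ v (A w))
    (hperp : ∀ B : V →L[ℝ] V, (∀ v w, inner ℝ (B v) w = -inner ℝ v (B w)) →
      (∀ v, B (J v) = J (B v)) →
      LinearMap.trace ℝ V ((J ∘L B : V →L[ℝ] V) : V →ₗ[ℝ] V) = 0 →
      LinearMap.trace ℝ V ((A ∘L B : V →L[ℝ] V) : V →ₗ[ℝ] V) = 0) :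
    complexLinearPart J A = (-(1 / (2 * n : ℝ)) *
      LinearMap.trace ℝ V ((A ∘L J : V →L[ℝ] V) : V →ₗ[ℝ] V)) • J := by
  set c : ℝ := -(1 / (2 * n : ℝ)) * LinearMap.trace ℝ V ((A ∘L J : V →L[ℝ] V) : V →ₗ[ℝ] V)
    with hc
  -- `B` lies in `su(n)`, is orthogonal to `A` and to `J`, and hence to itself.
  set B : V →L[ℝ] V := complexLinearPart J A - c • J with hB
  have B_skew : ∀ v w, inner ℝ (B v) w = -inner ℝ v (B w) := fun v w ↦ by
    have hJ_skew : inner ℝ (J v) w = -inner ℝ v (J w) := by rw [hJ.inner_right, neg_neg]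
    simp only [hB, sub_apply, smul_apply, inner_sub_left,
      inner_sub_right, real_inner_smul_left, real_inner_smul_right, hJ_skew,
      inner_complexLinearPart hJ hA v w]
    ring
  have B_comm : ∀ v, B (J v) = J (B v) := fun v ↦ by
    simp only [hB, sub_apply, smul_apply, map_sub, map_smul,
      complexLinearPart_comm hJ]
  have trace_B_comp : ∀ C : V →L[ℝ] V, (∀ v, C (J v) = J (C v)) →
      LinearMap.trace ℝ V ((B ∘L C : V →L[ℝ] V) : V →ₗ[ℝ] V) =
        LinearMap.trace ℝ V ((A ∘L C : V →L[ℝ] V) : V →ₗ[ℝ] V) -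
          c * LinearMap.trace ℝ V ((J ∘L C : V →L[ℝ] V) : V →ₗ[ℝ] V) := fun C hC ↦ by
    rw [← trace_complexLinearPart_comp (A := A) hJ hC, hB, ContinuousLinearMap.sub_comp,
      ContinuousLinearMap.smul_comp, ContinuousLinearMap.toLinearMap_sub, map_sub,
      ContinuousLinearMap.toLinearMap_smul, map_smul, smul_eq_mul]
  have trace_JJ : LinearMap.trace ℝ V ((J ∘L J : V →L[ℝ] V) : V →ₗ[ℝ] V) = -(2 * n) := by
    rw [show ((J ∘L J : V →L[ℝ] V) : V →ₗ[ℝ] V) = -1 from LinearMap.ext hJ.sq, map_neg,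
      LinearMap.trace_one, hdim, Nat.cast_mul, Nat.cast_ofNat]
  have trace_JB : LinearMap.trace ℝ V ((J ∘L B : V →L[ℝ] V) : V →ₗ[ℝ] V) = 0 := by
    rw [show J ∘L B = B ∘L J from ContinuousLinearMap.ext fun v ↦ (B_comm v).symm,
      trace_B_comp J fun _ ↦ rfl, trace_JJ, hc]
    have : (n : ℝ) ≠ 0 := Nat.cast_ne_zero.mpr hn
    field_simp
    ring
  have trace_BB := trace_B_comp B B_comm
  rw [hperp B B_skew B_comm trace_JB, trace_JB, mul_zero, sub_zero] at trace_BB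
  exact sub_eq_zero.mp (eq_zero_of_trace_comp_self B_skew trace_BB)

end ComplexLinearPart

section UnitaryFrame

variable {V : Type*} [NormedAddCommGroup V] [InnerProductSpace ℝ V] {n k : ℕ} {J : V →L[ℝ] V}

/-- A family of vectors that is orthonormal for the Hermitian product `⟨v, w⟩ + i ⟨v, J w⟩`. -/
structure IsUnitaryFrame (J : V →L[ℝ] V) (u : Fin k → V) : Prop where
  orthonormal : Orthonormal ℝ u
  inner_J : ∀ i j, inner ℝ (u i) (J (u j)) = 0

namespace IsUnitaryFrame

variable {u : Fin k → V}

theorem orthonormal_sumElim (hu : IsUnitaryFrame J u) (hJ : IsOrthComplex J) :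
    Orthonormal ℝ (Sum.elim u fun i ↦ J (u i)) := by
  have h := orthonormal_iff_ite.mp hu.orthonormal
  rw [orthonormal_iff_ite]
  rintro (i | i) (j | j)
  · simpa using h i j
  · simpa using hu.inner_J i j
  · simpa [real_inner_comm] using hu.inner_J j i
  · simpa [hJ.inner_map] using h i j

theorem cons (hu : IsUnitaryFrame J u) (hJ : IsOrthComplex J) {w : V} (hw : ‖w‖ = 1)
    (huw : ∀ i, inner ℝ (u i) w = 0) (hJuw : ∀ i, inner ℝ (J (u i)) w = 0) :
    IsUnitaryFrame J (Fin.cons w u : Fin (k + 1) → V) where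
  orthonormal := by
    have h := orthonormal_iff_ite.mp hu.orthonormal
    refine orthonormal_iff_ite.mpr fun i j ↦ ?_
    cases i using Fin.cases <;> cases j using Fin.cases
    · simp [hw]
    · simp [real_inner_comm _ w, huw, (Fin.succ_ne_zero _).symm]
    · simp [huw]
    · simpa using h _ _
  inner_J i j := by
    cases i using Fin.cases <;> cases j using Fin.cases
    · simp [hJ.inner_self]
    · simp [real_inner_comm _ w, hJuw]
    · simp [hJ.inner_right, hJuw]
    · simpa using hu.inner_J _ _

variable [FiniteDimensional ℝ V]

theorem exists_orthogonal (u : Fin k → V) (hk : 2 * k < Module.finrank ℝ V) :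
    ∃ w : V, ‖w‖ = 1 ∧ (∀ i, inner ℝ (u i) w = 0) ∧ ∀ i, inner ℝ (J (u i)) w = 0 := by
  let W := Submodule.span ℝ (Set.range (Sum.elim u fun i ↦ J (u i)))
  have finrank_W : Module.finrank ℝ W ≤ 2 * k :=
    (finrank_range_le_card _).trans (by simp [two_mul])
  have W_perp_ne_bot : Wᗮ ≠ ⊥ := fun h ↦ by
    have := W.finrank_add_finrank_orthogonal
    rw [h, finrank_bot] at this
    omega
  obtain ⟨w, hw, hw₀⟩ := Submodule.exists_mem_ne_zero_of_ne_bot W_perp_ne_bot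
  have hw' : ‖w‖⁻¹ • w ∈ Wᗮ := Wᗮ.smul_mem _ hw
  exact ⟨‖w‖⁻¹ • w, norm_smul_inv_norm hw₀,
    fun i ↦ hw' _ (Submodule.subset_span ⟨Sum.inl i, rfl⟩),
    fun i ↦ hw' _ (Submodule.subset_span ⟨Sum.inr i, rfl⟩)⟩

theorem exists_of_le (hJ : IsOrthComplex J) (hk : 2 * k ≤ Module.finrank ℝ V) :
    ∃ u : Fin k → V, IsUnitaryFrame J u := by
  induction k with
  | zero => exact ⟨Fin.elim0, ⟨fun i ↦ i.elim0, fun i ↦ i.elim0⟩, fun i ↦ i.elim0⟩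
  | succ k ih =>
    obtain ⟨u, hu⟩ := ih (by omega)
    obtain ⟨w, hw, huw, hJuw⟩ := exists_orthogonal (J := J) u (by omega)
    exact ⟨_, hu.cons hJ hw huw hJuw⟩

theorem exists_orthonormalBasis {u : Fin n → V} (hu : IsUnitaryFrame J u) (hJ : IsOrthComplex J)
    (hdim : Module.finrank ℝ V = 2 * n) :
    ∃ f : OrthonormalBasis (Fin n ⊕ Fin n) ℝ V,
      (∀ i, f (Sum.inl i) = u i) ∧ ∀ i, f (Sum.inr i) = J (u i) := by
  obtain ⟨f, hf⟩ := Orthonormal.exists_orthonormalBasis_extension_of_card_eq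
    (ι := Fin n ⊕ Fin n) (v := Sum.elim u fun i ↦ J (u i)) (s := Set.univ)
    (by simp [hdim, two_mul]) ((hu.orthonormal_sumElim hJ).comp _ Subtype.val_injective)
  exact ⟨f, fun i ↦ hf _ (Set.mem_univ _), fun i ↦ hf _ (Set.mem_univ _)⟩

theorem alternating_update {u : Fin n → V} (hu : IsUnitaryFrame J u) (hJ : IsOrthComplex J)
    (hdim : Module.finrank ℝ V = 2 * n) {Ψ : V [⋀^Fin n]→ₗ[ℝ] ℂ}
    (hΨ : ∀ (v : Fin n → V) i, Ψ (Function.update v i (J (v i))) = Complex.I * Ψ v)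
    (i : Fin n) (w : V) :
    Ψ (Function.update u i w) =
      ((inner ℝ (u i) w : ℝ) + (inner ℝ (J (u i)) w : ℝ) * Complex.I) * Ψ u := by
  obtain ⟨f, hf₁, hf₂⟩ := hu.exists_orthonormalBasis hJ hdim
  have update_u : ∀ j, j ≠ i → Ψ (Function.update u i (u j)) = 0 := fun j hj ↦
    Ψ.map_update_self u hj.symm
  have update_Ju : ∀ j, Ψ (Function.update u i (J (u j))) =
      Complex.I * Ψ (Function.update u i (u j)) := fun j ↦ by
    simpa using hΨ (Function.update u i (u j)) i
  conv_lhs => rw [← f.sum_repr' w, Fintype.sum_sum_type]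
  simp only [hf₁, hf₂, Ψ.map_update_add, Ψ.map_update_sum, Ψ.map_update_smul, update_Ju]
  rw [Finset.sum_eq_single i (fun j _ hj ↦ by rw [update_u j hj, smul_zero]) (by simp),
    Finset.sum_eq_single i (fun j _ hj ↦ by rw [update_u j hj, mul_zero, smul_zero]) (by simp),
    Function.update_eq_self, Complex.real_smul, Complex.real_smul]
  ring

end IsUnitaryFrame

end UnitaryFrame

section ComplexTrace

variable {V : Type*} [NormedAddCommGroup V] [InnerProductSpace ℝ V] {n : ℕ} {J : V →L[ℝ] V}
  {ι : Type*} [Fintype ι] (e : OrthonormalBasis ι ℝ V) {A B : V → V}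

theorem isBilinearMap_inner_comp (hA : IsLinearMap ℝ A) (hB : IsLinearMap ℝ B) :
    IsBilinearMap ℝ fun u v ↦ (inner ℝ (A u) (B v) : ℝ) where
  add_left u u' v := by rw [hA.map_add, inner_add_left]
  smul_left t u v := by rw [hA.map_smul, real_inner_smul_left, smul_eq_mul]
  add_right u v v' := by rw [hB.map_add, inner_add_right]
  smul_right t u v := by rw [hB.map_smul, real_inner_smul_right, smul_eq_mul]

theorem sum_inner_J_eq_zero_of_alternating [FiniteDimensional ℝ V] (hJ : IsOrthComplex J)
    (hdim : Module.finrank ℝ V = 2 * n) {Ψ : V [⋀^Fin n]→ₗ[ℝ] ℂ}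
    (hΨ : ∀ (v : Fin n → V) i, Ψ (Function.update v i (J (v i))) = Complex.I * Ψ v)
    (hΨ₀ : ∀ u : Fin n → V, IsUnitaryFrame J u → Ψ u ≠ 0)
    (hB : IsLinearMap ℝ B) (hBJ : ∀ v, B (J v) = J (B v))
    (hBΨ : ∀ u : Fin n → V, ∑ i, Ψ (Function.update u i (B (u i))) = 0) :
    ∑ i, inner ℝ (B (e i)) (J (e i)) = (0 : ℝ) := by
  obtain ⟨u, hu⟩ := IsUnitaryFrame.exists_of_le hJ hdim.ge
  obtain ⟨f, hf₁, hf₂⟩ := hu.exists_orthonormalBasis hJ hdim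
  have sum_frame : ∑ i, inner ℝ (J (u i)) (B (u i)) = (0 : ℝ) := by
    have h := hBΨ u
    simp only [hu.alternating_update hJ hdim hΨ, ← Finset.sum_mul] at h
    simpa using congrArg Complex.im ((mul_eq_zero.mp h).resolve_right (hΨ₀ u hu))
  rw [sum_basis_eq (isBilinearMap_inner_comp hB ⟨map_add J, map_smul J⟩) e f, Fintype.sum_sum_type]
  simp only [hf₁, hf₂, hBJ, hJ.inner_map, real_inner_comm (J (u _)),
    sum_frame, add_zero]

theorem sum_inner_comp_J_swap (hJ : IsOrthComplex J) (hA : IsLinearMap ℝ A)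
    (hB : IsLinearMap ℝ B) :
    ∑ i, inner ℝ (A (e i)) (B (J (e i))) = -∑ i, inner ℝ (B (e i)) (A (J (e i))) := by
  rw [← hJ.sum_basis e (isBilinearMap_inner_comp hA (isLinearMap_comp hB J))]
  simp only [hJ.sq, hB.map_neg, inner_neg_right, Finset.sum_neg_distrib, real_inner_comm (B _)]

theorem sum_inner_J_eq_zero_of_antilinear (hJ : IsOrthComplex J) (hB : IsLinearMap ℝ B)
    (hBJ : ∀ v, B (J v) = -J (B v)) : ∑ i, inner ℝ (B (e i)) (J (e i)) = (0 : ℝ) := by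
  have h := hJ.sum_basis e (isBilinearMap_inner_comp hB ⟨map_add J, map_smul J⟩)
  simp only [hBJ, inner_neg_left, hJ.inner_map,
    Finset.sum_neg_distrib] at h
  exact self_eq_neg.mp h.symm

end ComplexTrace

/-- The algebraic form of the curvature `R` of the Levi-Civita connection in terms of a connection
`∇ + ξ + η` with `η_u v = η̂(u) J v`: here `P` is the curvature of this connection, `N` stands for
the covariant derivative `∇̃ξ`, and `dη` for `dη̂`. -/
structure IsTorsionDecomposition {V : Type*} [NormedAddCommGroup V] [InnerProductSpace ℝ V]
    {ι : Type*} [Fintype ι] (J : V → V) (e : OrthonormalBasis ι ℝ V) (R : V → V → V → V → ℝ)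
    (P N : V → V → V → V) (ξ : V → V → V) (dη : V → V → ℝ) : Prop where
  curvature_J : ∀ u v w, P u v (J w) = J (P u v w)
  sum_curvature : ∀ u v, ∑ i, inner ℝ (P u v (e i)) (J (e i)) = (0 : ℝ)
  nabla_linear : ∀ u v, IsLinearMap ℝ (N u v)
  nabla_J : ∀ u v w, N u v (J w) = -J (N u v w)
  linear : ∀ u, IsLinearMap ℝ (ξ u)
  map_J : ∀ u v, ξ u (J v) = -J (ξ u v)
  skew : ∀ u v w, inner ℝ (ξ u v) w = (-inner ℝ v (ξ u w) : ℝ)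
  eq : ∀ u v w z, R u v w z = inner ℝ (P u v w + dη u v • J w + (N u v w - N v u w
    + ξ (ξ u v) w - ξ (ξ v u) w) - (ξ u (ξ v w) - ξ v (ξ u w))) z

namespace IsTorsionDecomposition

variable {V : Type*} [NormedAddCommGroup V] [InnerProductSpace ℝ V] {J : V →L[ℝ] V}
  {R : V → V → V → V → ℝ} {P N : V → V → V → V} {ξ : V → V → V} {dη : V → V → ℝ}

section Basis

variable {ι : Type*} [Fintype ι] {e : OrthonormalBasis ι ℝ V}

theorem sub_curvature_J (h : IsTorsionDecomposition J e R P N ξ dη) (hJ : IsOrthComplex J)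
    (u v w z : V) : R u v w z - R u v (J w) (J z) =
      2 * (inner ℝ (N u v w) z - inner ℝ (N v u w) z
        + inner ℝ (ξ (ξ u v) w) z - inner ℝ (ξ (ξ v u) w) z) := by
  simp only [h.eq, h.curvature_J, h.nabla_J, h.map_J, (h.linear _).map_neg, neg_neg,
    inner_add_left, inner_sub_left, inner_neg_left, real_inner_smul_left, hJ.inner_map]
  ring

theorem sum_curvature_J (h : IsTorsionDecomposition J e R P N ξ dη) (hJ : IsOrthComplex J)
    (u v : V) : ∑ i, R u v (e i) (J (e i)) =
      Fintype.card ι * dη u v - 2 * ∑ i, inner ℝ (ξ u (e i)) (ξ v (J (e i))) := by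
  have sum_ξ : ∀ a, ∑ i, inner ℝ (ξ a (e i)) (J (e i)) = (0 : ℝ) := fun a ↦
    sum_inner_J_eq_zero_of_antilinear e hJ (h.linear a) (h.map_J a)
  have sum_N : ∀ a b, ∑ i, inner ℝ (N a b (e i)) (J (e i)) = (0 : ℝ) := fun a b ↦
    sum_inner_J_eq_zero_of_antilinear e hJ (h.nabla_linear a b) (h.nabla_J a b)
  have expand : ∀ i, R u v (e i) (J (e i)) = inner ℝ (P u v (e i)) (J (e i)) + dη u v
      + inner ℝ (N u v (e i)) (J (e i)) - inner ℝ (N v u (e i)) (J (e i))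
      + inner ℝ (ξ (ξ u v) (e i)) (J (e i)) - inner ℝ (ξ (ξ v u) (e i)) (J (e i))
      + inner ℝ (ξ v (e i)) (ξ u (J (e i))) - inner ℝ (ξ u (e i)) (ξ v (J (e i))) := fun i ↦ by
    simp only [h.eq, inner_add_left, inner_sub_left, real_inner_smul_left, hJ.inner_map,
      real_inner_self_eq_norm_sq, e.norm_eq_one, h.skew u (ξ v (e i)), h.skew v (ξ u (e i))]
    ring
  simp only [expand, Finset.sum_add_distrib, Finset.sum_sub_distrib, h.sum_curvature, sum_N, sum_ξ,
    sum_inner_comp_J_swap e hJ (h.linear v) (h.linear u), Finset.sum_const, Finset.card_univ,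
    nsmul_eq_mul]
  ring

end Basis

variable {n : ℕ} {e : OrthonormalBasis (Fin (2 * n)) ℝ V}

theorem ricciOf_sub_ricciStarOf (h : IsTorsionDecomposition J e R P N ξ dη)
    (hJ : IsOrthComplex J) (u v : V) : ricciOf e R u v - ricciStarOf J e R u v =
      2 * ∑ i, (inner ℝ (N u (e i) v) (e i) - inner ℝ (N (e i) u v) (e i)
        + inner ℝ (ξ (ξ u (e i)) v) (e i) - inner ℝ (ξ (ξ (e i) u) v) (e i)) := by
  rw [ricciOf, ricciStarOf, ← Finset.sum_sub_distrib, Finset.mul_sum]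
  exact Finset.sum_congr rfl fun i _ ↦ h.sub_curvature_J hJ _ _ _ _

theorem three_ricciStarOf_add_ricciOf (h : IsTorsionDecomposition J e R P N ξ dη)
    (hJ : IsOrthComplex J) (hR : IsCurvature R) (X Y : V) :
    3 * hermPart J (ricciStarOf J e R) X Y + hermPart J (ricciOf e R) X Y =
      2 * n * dη X (J Y) - 2 * n * dη (J X) Y
      + ∑ i, (
        - inner ℝ (N (e i) X Y) (e i) + inner ℝ (N X (e i) Y) (e i)
        - inner ℝ (N (e i) (J X) (J Y)) (e i) + inner ℝ (N (J X) (e i) (J Y)) (e i)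
        - inner ℝ (ξ (ξ (e i) X) Y) (e i) + inner ℝ (ξ (ξ X (e i)) Y) (e i)
        - inner ℝ (ξ (ξ (e i) (J X)) (J Y)) (e i) + inner ℝ (ξ (ξ (J X) (e i)) (J Y)) (e i)
        - 2 * inner ℝ (ξ X (e i)) (ξ (J Y) (J (e i)))
        - 2 * inner ℝ (ξ Y (e i)) (ξ (J X) (J (e i)))) := by
  have star_XY := hR.two_ricciStarOf e hJ X Y
  have star_JXJY := hR.two_ricciStarOf e hJ (J X) (J Y)
  have ric_XY := h.ricciOf_sub_ricciStarOf hJ X Y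
  have ric_JXJY := h.ricciOf_sub_ricciStarOf hJ (J X) (J Y)
  simp only [hJ.sq, (hR.lin₂ _ _ _).map_neg, Finset.sum_neg_distrib] at star_JXJY
  rw [h.sum_curvature_J hJ, Fintype.card_fin, Nat.cast_mul, Nat.cast_ofNat] at star_XY star_JXJY
  rw [sum_inner_comp_J_swap e hJ (h.linear (J X)) (h.linear Y)] at star_JXJY
  simp only [Finset.sum_add_distrib, Finset.sum_sub_distrib, Finset.sum_neg_distrib,
    ← Finset.mul_sum] at ric_XY ric_JXJY ⊢
  simp only [hermPart]
  linear_combination star_XY + star_JXJY + ric_XY / 2 + ric_JXJY / 2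

end IsTorsionDecomposition

section Smooth

open Filter Topology

variable {E : Type*} [NormedAddCommGroup E] [NormedSpace ℝ E]
  {H : Type*} [TopologicalSpace H] {I : ModelWithCorners ℝ E H}
  {M : Type*} [TopologicalSpace M] [ChartedSpace H M] {x : M}

variable (I) in
/-- A function that is smooth on a neighbourhood of `x`. -/
def SmoothFunNear (f : M → ℝ) (x : M) : Prop :=
  ∀ᶠ y in 𝓝 x, ContMDiffAt I 𝓘(ℝ, ℝ) ∞ f y

namespace SmoothFunNear

variable {f g : M → ℝ}

theorem eventually (hf : SmoothFunNear I f x) : ∀ᶠ y in 𝓝 x, SmoothFunNear I f y :=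
  eventually_eventually_nhds.mpr hf

theorem mdiffAt (hf : SmoothFunNear I f x) : MDiffAt f x :=
  ContMDiffAt.mdifferentiableAt hf.self_of_nhds (by simp)

theorem congr (hf : SmoothFunNear I f x) (h : f =ᶠ[𝓝 x] g) : SmoothFunNear I g x := by
  filter_upwards [hf, h.eventuallyEq_nhds] with y hy hfg
  exact hy.congr_of_eventuallyEq hfg.symm

theorem const (c : ℝ) : SmoothFunNear I (fun _ : M ↦ c) x :=
  Eventually.of_forall fun _ ↦ contMDiffAt_const

end SmoothFunNear

theorem mvfderiv_congr {F : Type*} [NormedAddCommGroup F] [NormedSpace ℝ F] {f g : M → F}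
    (h : f =ᶠ[𝓝 x] g) (u : TangentSpace I x) : d% f x u = d% g x u :=
  congr($(h.mfderiv_eq (I := I) (I' := 𝓘(ℝ, F))) u)

variable [IsManifold I ∞ M]

/-- A vector field that is smooth on a neighbourhood of `x`. -/
def SmoothNear (X : Π x : M, TangentSpace I x) (x : M) : Prop :=
  ∀ᶠ y in 𝓝 x, CMDiffAt ∞ (T% X) y

variable {X Y Z : Π x : M, TangentSpace I x} {f : M → ℝ}

namespace SmoothNear

theorem eventually (hX : SmoothNear X x) : ∀ᶠ y in 𝓝 x, SmoothNear X y :=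
  eventually_eventually_nhds.mpr hX

theorem contMDiffAt (hX : SmoothNear X x) : CMDiffAt ∞ (T% X) x := hX.self_of_nhds

theorem mdiffAt (hX : SmoothNear X x) : MDiffAt (T% X) x :=
  hX.contMDiffAt.mdifferentiableAt (by simp)

theorem congr (hX : SmoothNear X x) (h : ∀ᶠ y in 𝓝 x, X y = Y y) : SmoothNear Y x := by
  filter_upwards [hX, eventually_eventually_nhds.mpr h] with y hy hXY
  refine hy.congr_of_eventuallyEq ?_
  filter_upwards [hXY] with z hz
  rw [hz]

theorem add (hX : SmoothNear X x) (hY : SmoothNear Y x) :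
    SmoothNear (fun y ↦ X y + Y y) x := by
  filter_upwards [hX, hY] with y h₁ h₂ using h₁.add_section h₂

theorem sub (hX : SmoothNear X x) (hY : SmoothNear Y x) :
    SmoothNear (fun y ↦ X y - Y y) x := by
  filter_upwards [hX, hY] with y h₁ h₂ using h₁.sub_section h₂

theorem neg (hX : SmoothNear X x) : SmoothNear (fun y ↦ -X y) x := by
  filter_upwards [hX] with y hy using hy.neg_section

theorem smul (hf : SmoothFunNear I f x) (hX : SmoothNear X x) :
    SmoothNear (fun y ↦ f y • X y) x := by
  filter_upwards [hf, hX] with y h₁ h₂ using h₁.smul_section h₂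

theorem const_smul (c : ℝ) (hX : SmoothNear X x) : SmoothNear (fun y ↦ c • X y) x :=
  smul (SmoothFunNear.const c) hX

theorem sum {ι : Type*} {s : Finset ι} {X : ι → Π x : M, TangentSpace I x}
    (hX : ∀ i ∈ s, SmoothNear (X i) x) : SmoothNear (fun y ↦ ∑ i ∈ s, X i y) x := by
  filter_upwards [(eventually_all_finset s).mpr hX] with y hy
  exact ContMDiffAt.sum_section hy

theorem connection {D : Connection I M} (hD : IsSmooth D) (hX : SmoothNear X x)
    (hY : SmoothNear Y x) : SmoothNear (fun y ↦ D Y y (X y)) x := by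
  filter_upwards [hX, hY] with y h₁ h₂ using hD X Y y h₁ h₂

theorem inner [RiemannianBundle (fun x : M ↦ TangentSpace I x)]
    [IsContMDiffRiemannianBundle I ∞ E (fun x : M ↦ TangentSpace I x)]
    (hX : SmoothNear X x) (hY : SmoothNear Y x) :
    SmoothFunNear I (fun y ↦ inner ℝ (X y) (Y y)) x := by
  filter_upwards [hX, hY] with y h₁ h₂ using
    ContMDiffAt.inner_bundle (F := E) (E := fun x : M ↦ TangentSpace I x) (b := fun y ↦ y) h₁ h₂

end SmoothNear

section Connection

variable (D : Connection I M)

theorem connection_add (hX : SmoothNear X x) (hY : SmoothNear Y x) (u : TangentSpace I x) :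
    D (fun y ↦ X y + Y y) x u = D X x u + D Y x u :=
  congr($(D.isCovariantDerivativeOn.add hX.mdiffAt hY.mdiffAt (Set.mem_univ x)) u)

theorem connection_smul (hf : SmoothFunNear I f x) (hX : SmoothNear X x) (u : TangentSpace I x) :
    D (fun y ↦ f y • X y) x u = f x • D X x u + d% f x u • X x :=
  congr($(D.isCovariantDerivativeOn.leibniz hX.mdiffAt hf.mdiffAt (Set.mem_univ x)) u)

theorem connection_congr (hX : SmoothNear X x) (h : ∀ᶠ y in 𝓝 x, X y = Y y)
    (u : TangentSpace I x) : D X x u = D Y x u :=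
  congr($(D.isCovariantDerivativeOn.congr_of_eventuallyEq (s := Set.univ) hX.mdiffAt
    (hX.congr h).mdiffAt univ_mem h) u)

theorem connection_const_smul (c : ℝ) (hX : SmoothNear X x) (u : TangentSpace I x) :
    D (fun y ↦ c • X y) x u = c • D X x u :=
  congr($(D.isCovariantDerivativeOn.smul_const c hX.mdiffAt (Set.mem_univ x)) u)

theorem connection_neg (hX : SmoothNear X x) (u : TangentSpace I x) :
    D (fun y ↦ -X y) x u = -D X x u := by
  simpa using connection_const_smul D (-1) hX u

theorem connection_sub (hX : SmoothNear X x) (hY : SmoothNear Y x) (u : TangentSpace I x) :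
    D (fun y ↦ X y - Y y) x u = D X x u - D Y x u := by
  simp only [sub_eq_add_neg]
  rw [connection_add D hX hY.neg, connection_neg D hY]

end Connection

theorem smoothNear_ext (v : TangentSpace I x) : SmoothNear (ext v) x := by
  obtain ⟨s, hs, h⟩ := FiberBundle.exists_contMDiffOn_extend (k := ∞) I E v
  filter_upwards [eventually_mem_nhds_iff.mpr hs] with y hy
  exact h.contMDiffAt hy

theorem ext_self (v : TangentSpace I x) : ext v x = v := FiberBundle.extend_apply_self E v

variable (I x) in
theorem exists_smoothNear_frame [FiniteDimensional ℝ E] :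
    ∃ (s : Fin (Module.finrank ℝ E) → Π y : M, TangentSpace I y)
      (c : Fin (Module.finrank ℝ E) → Π y : M, TangentSpace I y →ₗ[ℝ] ℝ),
    (∀ i, SmoothNear (s i) x) ∧
    (∀ i Z, SmoothNear Z x → SmoothFunNear I (fun y ↦ c i y (Z y)) x) ∧
    (∀ i, ∀ᶠ y in 𝓝 x, c i y (s i y) = 1) ∧
    ∀ Z : Π y : M, TangentSpace I y, ∀ᶠ y in 𝓝 x, Z y = ∑ i, c i y (Z y) • s i y := by
  let t := trivializationAt E (TangentSpace I : M → Type _) x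
  have hx : x ∈ t.baseSet := FiberBundle.mem_baseSet_trivializationAt E (TangentSpace I) x
  have mem_baseSet : ∀ᶠ y in 𝓝 x, y ∈ t.baseSet := t.open_baseSet.mem_nhds hx
  let b := Module.finBasis ℝ E
  refine ⟨t.localFrame b, t.localFrameCoeff I b, fun i ↦ ?_, fun i Z hZ ↦ ?_, fun i ↦ ?_,
    fun Z ↦ t.eventually_eq_localFrame_sum_coeff_smul b hx⟩
  · filter_upwards [mem_baseSet] with y hy using contMDiffAt_localFrame_of_mem ∞ _ b i hy
  · filter_upwards [hZ, mem_baseSet] with y hZy hy using contMDiffAt_localFrameCoeff b hy hZy i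
  · filter_upwards [mem_baseSet] with y hy
    rw [t.localFrameCoeff_apply_of_mem_baseSet b hy]
    simp [hy]

/-- A map on vector fields that is linear over the germs at `x` of smooth functions, so that it is
given by a tensor at `x`. -/
structure IsSmoothTensorial {A : Type*} [AddCommGroup A] [Module ℝ A]
    (Φ : (Π x : M, TangentSpace I x) → A) (x : M) : Prop where
  smul : ∀ {f : M → ℝ} {X : Π x : M, TangentSpace I x}, SmoothFunNear I f x → SmoothNear X x →
    Φ (fun y ↦ f y • X y) = f x • Φ X
  add : ∀ {X Y : Π x : M, TangentSpace I x}, SmoothNear X x → SmoothNear Y x →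
    Φ (fun y ↦ X y + Y y) = Φ X + Φ Y

namespace IsSmoothTensorial

variable {A : Type*} [AddCommGroup A] [Module ℝ A] {Φ : (Π x : M, TangentSpace I x) → A}

theorem congr (hΦ : IsSmoothTensorial Φ x) (hX : SmoothNear X x) (hY : SmoothNear Y x)
    (h : ∀ᶠ y in 𝓝 x, X y = Y y) : Φ X = Φ Y := by
  classical
  let ψ : M → ℝ := fun y ↦ if X y = Y y then 1 else 0
  have ψ_self : ψ x = 1 := by simp [ψ, h.self_of_nhds]
  have smul_eq : (fun y ↦ ψ y • X y) = fun y ↦ ψ y • Y y := by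
    funext y
    by_cases hy : X y = Y y <;> simp [ψ, hy]
  have hψ : SmoothFunNear I ψ x := (SmoothFunNear.const 1).congr <| by
    filter_upwards [h] with y hy
    simp [ψ, hy]
  calc Φ X = Φ (fun y ↦ ψ y • X y) := by rw [hΦ.smul hψ hX, ψ_self, one_smul]
    _ = Φ Y := by rw [smul_eq, hΦ.smul hψ hY, ψ_self, one_smul]

theorem zero (hΦ : IsSmoothTensorial Φ x) : Φ (fun _ ↦ 0) = 0 := by
  simpa using hΦ.smul (SmoothFunNear.const 0) (smoothNear_ext (0 : TangentSpace I x))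

theorem sum (hΦ : IsSmoothTensorial Φ x) {ι : Type*} {s : Finset ι}
    {X : ι → Π x : M, TangentSpace I x} (hX : ∀ i ∈ s, SmoothNear (X i) x) :
    Φ (fun y ↦ ∑ i ∈ s, X i y) = ∑ i ∈ s, Φ (X i) := by
  classical
  induction s using Finset.induction_on with
  | empty => simpa using hΦ.zero
  | insert a s ha ih =>
    simp only [Finset.mem_insert, forall_eq_or_imp] at hX
    simp only [Finset.sum_insert ha, ← ih hX.2]
    exact hΦ.add hX.1 (SmoothNear.sum hX.2)

variable [FiniteDimensional ℝ E]

theorem pointwise (hΦ : IsSmoothTensorial Φ x) (hX : SmoothNear X x) (hY : SmoothNear Y x)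
    (h : X x = Y x) : Φ X = Φ Y := by
  obtain ⟨s, c, hs, hc, -, eq_sum⟩ := exists_smoothNear_frame I x
  have expand : ∀ Z, SmoothNear Z x → Φ Z = ∑ i, c i x (Z x) • Φ (s i) := fun Z hZ ↦ by
    have hcs : ∀ i ∈ Finset.univ, SmoothNear (fun y ↦ c i y (Z y) • s i y) x :=
      fun i _ ↦ SmoothNear.smul (hc i Z hZ) (hs i)
    rw [hΦ.congr hZ (SmoothNear.sum hcs) (eq_sum Z), hΦ.sum hcs]
    exact Finset.sum_congr rfl fun i _ ↦ hΦ.smul (hc i Z hZ) (hs i)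
  rw [expand X hX, expand Y hY, h]

theorem isLinearMap_ext (hΦ : IsSmoothTensorial Φ x) :
    IsLinearMap ℝ fun v : TangentSpace I x ↦ Φ (ext v) where
  map_add v w := by
    rw [← hΦ.add (smoothNear_ext v) (smoothNear_ext w)]
    exact hΦ.pointwise (smoothNear_ext _) ((smoothNear_ext v).add (smoothNear_ext w))
      (by simp only [ext_self])
  map_smul c v := by
    refine Eq.trans ?_ (hΦ.smul (SmoothFunNear.const c) (smoothNear_ext v))
    exact hΦ.pointwise (smoothNear_ext _) ((smoothNear_ext v).const_smul c)
      (by simp only [ext_self])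

end IsSmoothTensorial

section LieBracket

variable [CompleteSpace E]

theorem SmoothNear.mlieBracket (hX : SmoothNear X x) (hY : SmoothNear Y x) :
    SmoothNear (mlieBracket I X Y) x := by
  have : IsManifold I ((⊤ : ℕ∞) + 1) M := inferInstanceAs (IsManifold I ∞ M)
  have : IsManifold I (minSmoothness ℝ 2) M := by
    rw [minSmoothness_of_isRCLikeNormedField]; infer_instance
  filter_upwards [hX, hY] with y h₁ h₂
  exact ContMDiffAt.mlieBracket_vectorField (m := ⊤) (n := ⊤) h₁ h₂ (by simp)

theorem mlieBracket_fun_smul (hf : SmoothFunNear I f x) (hY : SmoothNear Y x) :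
    mlieBracket I X (fun y ↦ f y • Y y) x = d% f x (X x) • Y x + f x • mlieBracket I X Y x :=
  mlieBracket_smul_right hf.mdiffAt hY.mdiffAt

theorem mlieBracket_mlieBracket_eq_add (hX : SmoothNear X x) (hY : SmoothNear Y x)
    (hZ : SmoothNear Z x) :
    mlieBracket I X (mlieBracket I Y Z) x =
      mlieBracket I (mlieBracket I X Y) Z x + mlieBracket I Y (mlieBracket I X Z) x := by
  have : IsManifold I (minSmoothness ℝ 3) M := by
    rw [minSmoothness_of_isRCLikeNormedField]; infer_instance
  have contMDiffAt_two : ∀ {W : Π x : M, TangentSpace I x}, SmoothNear W x →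
      CMDiffAt (minSmoothness ℝ 2) (T% W) x := fun hW ↦ by
    rw [minSmoothness_of_isRCLikeNormedField]
    exact hW.contMDiffAt.of_le ENat.LEInfty.out
  exact leibniz_identity_mlieBracket_apply (contMDiffAt_two hX) (contMDiffAt_two hY)
    (contMDiffAt_two hZ)

end LieBracket

section Deriv

variable [FiniteDimensional ℝ E]

theorem SmoothFunNear.of_smul [Nontrivial E]
    (h : ∀ W : Π x : M, TangentSpace I x, SmoothNear W x → SmoothNear (fun y ↦ f y • W y) x) :
    SmoothFunNear I f x := by
  obtain ⟨s, c, hs, hc, coeff_self, -⟩ := exists_smoothNear_frame I x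
  let i : Fin (Module.finrank ℝ E) := ⟨0, Module.finrank_pos⟩
  refine (hc i _ (h (s i) (hs i))).congr ?_
  filter_upwards [coeff_self i] with y hy
  simp [hy]

theorem SmoothFunNear.mvfderiv (hf : SmoothFunNear I f x) (hX : SmoothNear X x) :
    SmoothFunNear I (fun y ↦ d% f y (X y)) x := by
  cases subsingleton_or_nontrivial E with
  | inl h =>
    refine (SmoothFunNear.const 0).congr (Eventually.of_forall fun y ↦ ?_)
    have : Subsingleton (TangentSpace I y) := h
    simp only [Subsingleton.elim (X y) 0, map_zero]
  | inr h =>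
    -- `d f(X) W = [X, f W] - f [X, W]`
    refine of_smul fun W hW ↦ ((hX.mlieBracket (SmoothNear.smul hf hW)).sub
      (SmoothNear.smul hf (hX.mlieBracket hW))).congr ?_
    filter_upwards [hf.eventually, hW.eventually] with y hfy hWy
    rw [mlieBracket_fun_smul hfy hWy, add_sub_cancel_right]

theorem mlieBracket_mlieBracket_fun_smul (hf : SmoothFunNear I f x)
    (hY : SmoothNear Y x) (hZ : SmoothNear Z x) :
    mlieBracket I X (mlieBracket I Y fun y ↦ f y • Z y) x =
      d% (fun y ↦ d% f y (Y y)) x (X x) • Z x + d% f x (Y x) • mlieBracket I X Z x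
        + (d% f x (X x) • mlieBracket I Y Z x + f x • mlieBracket I X (mlieBracket I Y Z) x) := by
  have hdf := hf.mvfderiv hY
  have hYZ := hY.mlieBracket hZ
  calc mlieBracket I X (mlieBracket I Y fun y ↦ f y • Z y) x
      = mlieBracket I X (fun y ↦ d% f y (Y y) • Z y + f y • mlieBracket I Y Z y) x := by
        refine Filter.EventuallyEq.mlieBracket_vectorField_eq EventuallyEq.rfl ?_
        filter_upwards [hf.eventually, hZ.eventually] with y hfy hZy
          using mlieBracket_fun_smul hfy hZy
    _ = mlieBracket I X (fun y ↦ d% f y (Y y) • Z y) x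
        + mlieBracket I X (fun y ↦ f y • mlieBracket I Y Z y) x :=
      mlieBracket_add_right (SmoothNear.smul hdf hZ).mdiffAt (SmoothNear.smul hf hYZ).mdiffAt
    _ = _ := by rw [mlieBracket_fun_smul hdf hZ, mlieBracket_fun_smul hf hYZ]

theorem mvfderiv_mvfderiv_sub_swap (hf : SmoothFunNear I f x) (hX : SmoothNear X x)
    (hY : SmoothNear Y x) :
    d% (fun y ↦ d% f y (Y y)) x (X x) - d% (fun y ↦ d% f y (X y)) x (Y x) =
      d% f x (mlieBracket I X Y x) := by
  cases subsingleton_or_nontrivial E with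
  | inl h =>
    have : Subsingleton (TangentSpace I x) := h
    simp only [Subsingleton.elim _ (0 : TangentSpace I x), map_zero, sub_zero]
  | inr h =>
    -- Compare the Jacobi identities for `X`, `Y`, `f W` and for `X`, `Y`, `W`, where `W x ≠ 0`.
    obtain ⟨w, hw⟩ : ∃ w : TangentSpace I x, w ≠ 0 := (exists_ne (0 : E) : ∃ w : E, w ≠ 0)
    have hW := smoothNear_ext w
    have jacobi := mlieBracket_mlieBracket_eq_add hX hY (SmoothNear.smul hf hW)
    rw [mlieBracket_mlieBracket_fun_smul hf hY hW, mlieBracket_mlieBracket_fun_smul hf hX hW,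
      mlieBracket_fun_smul hf hW, mlieBracket_mlieBracket_eq_add hX hY hW, ext_self] at jacobi
    refine sub_eq_zero.mp ((smul_eq_zero.mp (?_ : _ • w = 0)).resolve_right hw)
    linear_combination (norm := module) jacobi

end Deriv

end Smooth

theorem pair_symm_of_bianchi {V : Type*} {K : V → V → V → V → ℝ}
    (antisymm : ∀ a b c d, K b a c d = -K a b c d) (antisymm' : ∀ a b c d, K a b d c = -K a b c d)
    (bianchi : ∀ a b c d, K a b c d + K b c a d + K c a b d = 0) (a b c d : V) :
    K c d a b = K a b c d := by
  linarith [bianchi a b c d, bianchi b c d a, bianchi c d a b, bianchi d a b c, antisymm' b c a d,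
    antisymm' c d a b, antisymm b d c a, antisymm a d c b, antisymm' a d b c, antisymm c a d b,
    antisymm' c a b d, antisymm a d b c, antisymm' a b c d, antisymm' b d c a]

section Curvature

open Filter Topology

variable {E : Type*} [NormedAddCommGroup E] [NormedSpace ℝ E]
  {H : Type*} [TopologicalSpace H] {I : ModelWithCorners ℝ E H}
  {M : Type*} [TopologicalSpace M] [ChartedSpace H M] [IsManifold I ∞ M]
  {D : Connection I M} {X Y Z : Π x : M, TangentSpace I x} {f : M → ℝ} {x : M}

theorem connection_connection_add (hD : IsSmooth D) {Z' : Π x : M, TangentSpace I x}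
    (hY : SmoothNear Y x) (hZ : SmoothNear Z x) (hZ' : SmoothNear Z' x) (u : TangentSpace I x) :
    D (fun y ↦ D (fun y ↦ Z y + Z' y) y (Y y)) x u =
      D (fun y ↦ D Z y (Y y)) x u + D (fun y ↦ D Z' y (Y y)) x u := by
  rw [← connection_add D (SmoothNear.connection hD hY hZ) (SmoothNear.connection hD hY hZ')]
  refine connection_congr D (SmoothNear.connection hD hY (hZ.add hZ')) ?_ u
  filter_upwards [hZ.eventually, hZ'.eventually] with y h h' using connection_add D h h' _

theorem curvatureOp_swap : curvatureOp D Y X Z x = -curvatureOp D X Y Z x := by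
  simp only [curvatureOp]
  rw [mlieBracket_swap_apply, map_neg]
  abel

theorem mvfderiv_mvfderiv_inner_self
    [RiemannianBundle (fun x : M ↦ TangentSpace I x)] (hD : IsSmooth D) (hm : IsMetric D)
    (hY : SmoothNear Y x) (hZ : SmoothNear Z x) (u : TangentSpace I x) :
    d% (fun y ↦ d% (fun y ↦ (inner ℝ (Z y) (Z y) : ℝ)) y (Y y)) x u =
      2 * (inner ℝ (D (fun y ↦ D Z y (Y y)) x u) (Z x) + inner ℝ (D Z x (Y x)) (D Z x u)) := by
  have hDZ := SmoothNear.connection hD hY hZ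
  have deriv_eq : (fun y ↦ d% (fun y ↦ (inner ℝ (Z y) (Z y) : ℝ)) y (Y y)) =ᶠ[𝓝 x]
      fun y ↦ inner ℝ ((2 : ℝ) • D Z y (Y y)) (Z y) := by
    filter_upwards [hZ] with y h
    rw [hm Z Z y (Y y) h h, real_inner_comm (D Z y (Y y)), real_inner_smul_left]
    ring
  rw [mvfderiv_congr deriv_eq, hm _ Z x u (hDZ.const_smul 2).contMDiffAt hZ.contMDiffAt,
    connection_const_smul D 2 hDZ, real_inner_smul_left, real_inner_smul_left]
  ring

section

variable [CompleteSpace E]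

theorem curvatureOp_tensorial_left (hD : IsSmooth D) (hZ : SmoothNear Z x) :
    IsSmoothTensorial (fun X ↦ curvatureOp D X Y Z x) x where
  smul {f X} hf hX := by
    have bracket_smul : mlieBracket I (fun y ↦ f y • X y) Y x =
        -(d% f x (Y x) • X x) + f x • mlieBracket I X Y x :=
      (mlieBracket_smul_left hf.mdiffAt hX.mdiffAt).trans (by rw [neg_smul])
    simp only [curvatureOp, map_smul]
    rw [connection_smul D hf (SmoothNear.connection hD hX hZ), bracket_smul, map_add, map_neg,
      map_smul, map_smul]
    module
  add {X X'} hX hX' := by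
    have bracket_add :
        mlieBracket I (fun y ↦ X y + X' y) Y x = mlieBracket I X Y x + mlieBracket I X' Y x :=
      mlieBracket_add_left hX.mdiffAt hX'.mdiffAt
    simp only [curvatureOp, map_add]
    rw [connection_add D (SmoothNear.connection hD hX hZ) (SmoothNear.connection hD hX' hZ),
      bracket_add, map_add]
    abel

theorem mlieBracket_jacobi (hX : SmoothNear X x) (hY : SmoothNear Y x) (hZ : SmoothNear Z x) :
    mlieBracket I (mlieBracket I X Y) Z x + mlieBracket I (mlieBracket I Y Z) X x
      + mlieBracket I (mlieBracket I Z X) Y x = 0 := by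
  have neg_left :
      mlieBracket I (-mlieBracket I Z X) Y x = -mlieBracket I (mlieBracket I Z X) Y x := by
    simpa using mlieBracket_const_smul_left (W := Y) (c := (-1 : ℝ)) (hZ.mlieBracket hX).mdiffAt
  have leibniz := mlieBracket_mlieBracket_eq_add hX hY hZ
  rw [mlieBracket_swap_apply (V := X) (W := mlieBracket I Y Z),
    mlieBracket_swap_apply (V := Y) (W := mlieBracket I X Z),
    mlieBracket_swap (V := X) (W := Z), neg_left] at leibniz
  linear_combination (norm := module) -leibniz

end

variable [FiniteDimensional ℝ E]

theorem connection_sub_swap (hD : D.torsion = 0) (hX : SmoothNear X x) (hY : SmoothNear Y x) :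
    D Y x (X x) - D X x (Y x) = mlieBracket I X Y x :=
  (CovariantDerivative.torsion_eq_zero_iff D).mp hD hX.mdiffAt hY.mdiffAt

theorem connection_mlieBracket (hD : IsSmooth D) (hD₀ : D.torsion = 0) (hX : SmoothNear X x)
    (hY : SmoothNear Y x) (u : TangentSpace I x) :
    D (mlieBracket I X Y) x u =
      D (fun y ↦ D Y y (X y)) x u - D (fun y ↦ D X y (Y y)) x u := by
  have hXY := SmoothNear.connection hD hX hY
  have hYX := SmoothNear.connection hD hY hX
  rw [← connection_sub D hXY hYX]
  refine (connection_congr D (hXY.sub hYX) ?_ u).symm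
  filter_upwards [hX.eventually, hY.eventually] with y h h' using connection_sub_swap hD₀ h h'

theorem curvatureOp_bianchi (hD : IsSmooth D) (hD₀ : D.torsion = 0) (hX : SmoothNear X x)
    (hY : SmoothNear Y x) (hZ : SmoothNear Z x) :
    curvatureOp D X Y Z x + curvatureOp D Y Z X x + curvatureOp D Z X Y x = 0 := by
  have double_bracket : ∀ {X Y Z : Π x : M, TangentSpace I x}, SmoothNear X x → SmoothNear Y x →
      SmoothNear Z x → D Z x (mlieBracket I X Y x) -
        (D (fun y ↦ D Y y (X y)) x (Z x) - D (fun y ↦ D X y (Y y)) x (Z x)) =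
        mlieBracket I (mlieBracket I X Y) Z x := fun hX hY hZ ↦ by
    rw [← connection_mlieBracket hD hD₀ hX hY, connection_sub_swap hD₀ (hX.mlieBracket hY) hZ]
  simp only [curvatureOp]
  linear_combination (norm := module) double_bracket hX hY hZ + double_bracket hY hZ hX
    + double_bracket hZ hX hY + mlieBracket_jacobi hX hY hZ

theorem connection_connection_smul (hD : IsSmooth D) (hf : SmoothFunNear I f x)
    (hY : SmoothNear Y x) (hZ : SmoothNear Z x) (u : TangentSpace I x) :
    D (fun y ↦ D (fun y ↦ f y • Z y) y (Y y)) x u =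
      f x • D (fun y ↦ D Z y (Y y)) x u + d% f x u • D Z x (Y x)
        + (d% f x (Y x) • D Z x u + d% (fun y ↦ d% f y (Y y)) x u • Z x) := by
  have hDZ := SmoothNear.connection hD hY hZ
  have hdf := hf.mvfderiv hY
  calc D (fun y ↦ D (fun y ↦ f y • Z y) y (Y y)) x u
      = D (fun y ↦ f y • D Z y (Y y) + d% f y (Y y) • Z y) x u := by
        refine connection_congr D (SmoothNear.connection hD hY (SmoothNear.smul hf hZ)) ?_ u
        filter_upwards [hf.eventually, hZ.eventually] with y h h' using connection_smul D h h' _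
    _ = _ := by
        rw [connection_add D (SmoothNear.smul hf hDZ) (SmoothNear.smul hdf hZ),
          connection_smul D hf hDZ, connection_smul D hdf hZ]

theorem curvatureOp_tensorial_right (hD : IsSmooth D) (hX : SmoothNear X x)
    (hY : SmoothNear Y x) : IsSmoothTensorial (fun Z ↦ curvatureOp D X Y Z x) x where
  smul {f Z} hf hZ := by
    simp only [curvatureOp]
    rw [connection_connection_smul hD hf hY hZ, connection_connection_smul hD hf hX hZ,
      connection_smul D hf hZ, ← mvfderiv_mvfderiv_sub_swap hf hX hY]
    module
  add {Z Z'} hZ hZ' := by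
    simp only [curvatureOp]
    rw [connection_connection_add hD hX hZ hZ', connection_connection_add hD hY hZ hZ',
      connection_add D hZ hZ']
    abel

theorem isLinearMap_curvatureOp_ext (hD : IsSmooth D) (u v : TangentSpace I x) :
    IsLinearMap ℝ fun w : TangentSpace I x ↦ curvatureOp D (ext u) (ext v) (ext w) x :=
  (curvatureOp_tensorial_right hD (smoothNear_ext u) (smoothNear_ext v)).isLinearMap_ext

variable [RiemannianBundle (fun x : M ↦ TangentSpace I x)]
  [IsContMDiffRiemannianBundle I ∞ E (fun x : M ↦ TangentSpace I x)]

theorem inner_curvatureOp_self (hD : IsSmooth D) (hm : IsMetric D)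
    (hX : SmoothNear X x) (hY : SmoothNear Y x) (hZ : SmoothNear Z x) :
    inner ℝ (curvatureOp D X Y Z x) (Z x) = (0 : ℝ) := by
  -- `⟨R_{X,Y} Z, Z⟩` is half of `([X, Y] - X Y + Y X) ⟨Z, Z⟩`.
  have commutator := mvfderiv_mvfderiv_sub_swap (hZ.inner hZ) hX hY
  rw [mvfderiv_mvfderiv_inner_self hD hm hY hZ, mvfderiv_mvfderiv_inner_self hD hm hX hZ,
    hm Z Z x _ hZ.contMDiffAt hZ.contMDiffAt, real_inner_comm (D Z x (X x)) (D Z x (Y x)),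
    real_inner_comm (D Z x (mlieBracket I X Y x)) (Z x)] at commutator
  simp only [curvatureOp, inner_add_left, inner_sub_left]
  linarith

theorem riem_swap_right (hD : IsSmooth D) (hm : IsMetric D) (a b c d : TangentSpace I x) :
    riem D x a b d c = -riem D x a b c d := by
  have riem_self : ∀ c : TangentSpace I x, riem D x a b c c = 0 := fun c ↦ by
    have h := inner_curvatureOp_self hD hm (smoothNear_ext a) (smoothNear_ext b) (smoothNear_ext c)
    rwa [ext_self] at h
  have h := riem_self (c + d)
  have hc := riem_self c
  have hd := riem_self d
  simp only [riem] at h hc hd ⊢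
  rw [(isLinearMap_curvatureOp_ext hD a b).map_add, inner_add_left, inner_add_right,
    inner_add_right, hc, hd] at h
  linarith

theorem isCurvature_riem (hD : IsLeviCivita D) (x : M) : IsCurvature (riem D x) := by
  have antisymm : ∀ a b c d : TangentSpace I x, riem D x b a c d = -riem D x a b c d :=
    fun a b c d ↦ by rw [riem, curvatureOp_swap, inner_neg_left, riem]
  have bianchi : ∀ a b c d : TangentSpace I x,
      riem D x a b c d + riem D x b c a d + riem D x c a b d = 0 := fun a b c d ↦ by
    simp only [riem]
    rw [← inner_add_left, ← inner_add_left, curvatureOp_bianchi hD.smooth hD.torsion_free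
      (smoothNear_ext a) (smoothNear_ext b) (smoothNear_ext c), inner_zero_left]
  have linear_left : ∀ b c : TangentSpace I x,
      IsLinearMap ℝ fun a : TangentSpace I x ↦ curvatureOp D (ext a) (ext b) (ext c) x :=
    fun b c ↦ (curvatureOp_tensorial_left hD.smooth (smoothNear_ext c)).isLinearMap_ext
  refine ⟨fun a a' b c d ↦ ?_, fun t a b c d ↦ ?_, antisymm,
    pair_symm_of_bianchi antisymm (riem_swap_right hD.smooth hD.metric) bianchi, bianchi⟩
  · simp only [riem, (linear_left b c).map_add, inner_add_left]
  · simp only [riem, (linear_left b c).map_smul, real_inner_smul_left]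

end Curvature

section MinimalConnection

open Filter Topology

variable {n : ℕ} {E : Type*} [NormedAddCommGroup E] [NormedSpace ℝ E]
  {H : Type*} [TopologicalSpace H] {I : ModelWithCorners ℝ E H}
  {M : Type*} [TopologicalSpace M] [ChartedSpace H M] [IsManifold I ∞ M]
  [RiemannianBundle (fun x : M ↦ TangentSpace I x)]
  {S : SpecialAlmostHermitian n I M} {D Dbar : Connection I M}
  {X Y Z W : Π x : M, TangentSpace I x} {f : M → ℝ} {x : M}

theorem SpecialAlmostHermitian.isOrthComplex (S : SpecialAlmostHermitian n I M) (x : M) :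
    IsOrthComplex (S.J x) := ⟨S.J_J x, S.J_inner x⟩

theorem SmoothNear.J (S : SpecialAlmostHermitian n I M) (hX : SmoothNear X x) :
    SmoothNear (fun y ↦ S.J y (X y)) x := by
  filter_upwards [hX] with y h using S.J_smooth X y h

theorem inner_xi (hD : IsMetric D) (u v w : TangentSpace I x) :
    (inner ℝ (xi S D x u v) w : ℝ) = -inner ℝ v (xi S D x u w) := by
  have hJ := S.isOrthComplex x
  have hv := smoothNear_ext v
  have hw := smoothNear_ext w
  have inner_xi_left : ∀ a b : TangentSpace I x, (inner ℝ (xi S D x u a) b : ℝ) =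
      1 / 2 * (inner ℝ (D (fun y ↦ S.J y (ext a y)) x u) (S.J x b)
        - inner ℝ (D (ext a) x u) b) := fun a b ↦ by
    simp only [xi, map_sub, S.J_J, real_inner_smul_left, inner_sub_left, inner_neg_left,
      hJ.inner_right]
    ring
  -- Differentiate `⟨V, W⟩ = ⟨J V, J W⟩`.
  have deriv_inner := hD _ _ x u hv.contMDiffAt hw.contMDiffAt
  have deriv_inner_J := hD _ _ x u (hv.J S).contMDiffAt (hw.J S).contMDiffAt
  simp only [S.J_inner, ext_self] at deriv_inner deriv_inner_J
  rw [real_inner_comm (D _ x u)] at deriv_inner deriv_inner_J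
  rw [real_inner_comm (xi S D x u w) v, inner_xi_left, inner_xi_left]
  linarith

theorem xi_add_left (u u' v : TangentSpace I x) :
    xi S D x (u + u') v = xi S D x u v + xi S D x u' v := by
  simp only [xi, map_add, map_sub]
  module

theorem xi_sub_left (u u' v : TangentSpace I x) :
    xi S D x (u - u') v = xi S D x u v - xi S D x u' v := by
  simp only [xi, map_sub]
  module

theorem xi_tensorial (S : SpecialAlmostHermitian n I M) (D : Connection I M)
    (u : TangentSpace I x) : IsSmoothTensorial (fun W : Π x : M, TangentSpace I x ↦
      -(1 / 2 : ℝ) • S.J x (D (fun y ↦ S.J y (W y)) x u - S.J x (D W x u))) x where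
  smul {f W} hf hW := by
    simp only [map_smul]
    rw [connection_smul D hf (hW.J S), connection_smul D hf hW]
    simp only [map_sub, map_add, map_smul]
    module
  add {W W'} hW hW' := by
    simp only [map_add]
    rw [connection_add D (hW.J S) (hW'.J S), connection_add D hW hW']
    simp only [map_sub, map_add]
    module

theorem nablaTilde_congr (hX : SmoothNear X x) (h : ∀ᶠ y in 𝓝 x, X y = Y y)
    (u : TangentSpace I x) : nablaTilde S D X x u = nablaTilde S D Y x u := by
  simp only [nablaTilde]
  rw [connection_congr D hX h, h.self_of_nhds]

variable [FiniteDimensional ℝ E]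

theorem diff_apply (u : TangentSpace I x) (hW : SmoothNear W x) :
    diff D Dbar x u (W x) = Dbar W x u - D W x u :=
  congr($(IsCovariantDerivativeOn.difference_apply Dbar.isCovariantDerivativeOnUniv
    D.isCovariantDerivativeOnUniv (Set.mem_univ x) hW.mdiffAt) u)

theorem xi_apply (u : TangentSpace I x) (hW : SmoothNear W x) : xi S D x u (W x) =
    -(1 / 2 : ℝ) • S.J x (D (fun y ↦ S.J y (W y)) x u - S.J x (D W x u)) :=
  (xi_tensorial S D u).pointwise (smoothNear_ext _) hW (ext_self _)

theorem isLinearMap_xi (u : TangentSpace I x) : IsLinearMap ℝ (xi S D x u) :=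
  (xi_tensorial S D u).isLinearMap_ext

theorem xi_J (u v : TangentSpace I x) : xi S D x u (S.J x v) = -S.J x (xi S D x u v) := by
  have hv := smoothNear_ext v
  have xi_Jv := xi_apply (S := S) (D := D) u (hv.J S)
  simp only [S.J_J, ext_self] at xi_Jv
  rw [connection_neg D hv] at xi_Jv
  rw [xi_Jv, xi]
  simp only [map_sub, map_neg, map_smul, S.J_J]
  module

theorem SmoothNear.xi (hD : IsSmooth D) (hX : SmoothNear X x) (hW : SmoothNear W x) :
    SmoothNear (fun y ↦ xi S D y (X y) (W y)) x := by
  have hDJW := SmoothNear.connection hD hX (hW.J S)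
  have hJDW := (SmoothNear.connection hD hX hW).J S
  refine (((hDJW.sub hJDW).J S).const_smul (-(1 / 2))).congr ?_
  filter_upwards [hW.eventually] with y hy using (xi_apply _ hy).symm

section NablaTilde

theorem nablaTilde_add (hX : SmoothNear X x) (hY : SmoothNear Y x) (u : TangentSpace I x) :
    nablaTilde S D (fun y ↦ X y + Y y) x u = nablaTilde S D X x u + nablaTilde S D Y x u := by
  simp only [nablaTilde]
  rw [connection_add D hX hY, (isLinearMap_xi u).map_add]
  abel

theorem nablaTilde_smul (hf : SmoothFunNear I f x) (hY : SmoothNear Y x) (u : TangentSpace I x) :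
    nablaTilde S D (fun y ↦ f y • Y y) x u = f x • nablaTilde S D Y x u + d% f x u • Y x := by
  simp only [nablaTilde]
  rw [connection_smul D hf hY, (isLinearMap_xi u).map_smul]
  module

theorem nablaTilde_neg (hX : SmoothNear X x) (u : TangentSpace I x) :
    nablaTilde S D (fun y ↦ -X y) x u = -nablaTilde S D X x u := by
  simp only [nablaTilde]
  rw [connection_neg D hX, (isLinearMap_xi u).map_neg]
  abel

theorem SmoothNear.nablaTilde (hD : IsSmooth D) (hX : SmoothNear X x) (hY : SmoothNear Y x) :
    SmoothNear (fun y ↦ nablaTilde S D Y y (X y)) x :=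
  (SmoothNear.connection hD hX hY).add (SmoothNear.xi hD hX hY)

theorem nablaXi_tensorial (hD : IsSmooth D) (u v : TangentSpace I x) :
    IsSmoothTensorial (fun W : Π x : M, TangentSpace I x ↦
      nablaTilde S D (fun y ↦ xi S D y (ext v y) (W y)) x u
        - xi S D x (nablaTilde S D (ext v) x u) (W x) - xi S D x v (nablaTilde S D W x u)) x where
  smul {f W} hf hW := by
    have hxi : SmoothNear (fun y ↦ xi S D y (ext v y) (W y)) x :=
      SmoothNear.xi hD (smoothNear_ext v) hW
    simp only [(isLinearMap_xi _).map_smul]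
    rw [nablaTilde_smul hf hxi, nablaTilde_smul hf hW, (isLinearMap_xi _).map_add,
      (isLinearMap_xi _).map_smul, (isLinearMap_xi _).map_smul, ext_self]
    module
  add {W W'} hW hW' := by
    have smoothNear_xi : ∀ {W : Π x : M, TangentSpace I x}, SmoothNear W x →
        SmoothNear (fun y ↦ xi S D y (ext v y) (W y)) x := SmoothNear.xi hD (smoothNear_ext v)
    simp only [(isLinearMap_xi _).map_add]
    rw [nablaTilde_add (smoothNear_xi hW) (smoothNear_xi hW'), nablaTilde_add hW hW',
      (isLinearMap_xi _).map_add]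
    abel

theorem nablaXi_apply (hD : IsSmooth D) (u v : TangentSpace I x) (hW : SmoothNear W x) :
    nablaXi S D x u v (W x) = nablaTilde S D (fun y ↦ xi S D y (ext v y) (W y)) x u
        - xi S D x (nablaTilde S D (ext v) x u) (W x) - xi S D x v (nablaTilde S D W x u) := by
  have h := (nablaXi_tensorial (S := S) hD u v).pointwise (smoothNear_ext (W x)) hW (ext_self _)
  simp only [ext_self] at h
  exact h

theorem isLinearMap_nablaXi (hD : IsSmooth D) (u v : TangentSpace I x) :
    IsLinearMap ℝ (nablaXi S D x u v) := by
  have h := (nablaXi_tensorial (S := S) hD u v).isLinearMap_ext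
  simp only [ext_self] at h
  exact h

end NablaTilde

section MinimalSU

theorem xi_eq_diff_sub_complexLinearPart (hDbar : IsMinimalSU S D Dbar) (u v : TangentSpace I x) :
    xi S D x u v = diff D Dbar x u v - complexLinearPart (S.J x) (diff D Dbar x u) v := by
  have hv := smoothNear_ext v
  have diff_v := diff_apply (D := D) (Dbar := Dbar) u hv
  have diff_Jv := diff_apply (D := D) (Dbar := Dbar) u (hv.J S)
  rw [hDbar.parallel_J _ x u hv.contMDiffAt] at diff_Jv
  rw [ext_self] at diff_v diff_Jv
  rw [complexLinearPart_apply, diff_v, diff_Jv, xi]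
  simp only [map_sub, S.J_J]
  module

variable (hn : n ≠ 0) (hdim : Module.finrank ℝ E = 2 * n)
include hn hdim

theorem diff_eq_xi_add_etaHat (hDbar : IsMinimalSU S D Dbar) (u v : TangentSpace I x) :
    diff D Dbar x u v = xi S D x u v + etaHat S D Dbar x u • S.J x v := by
  have : FiniteDimensional ℝ (TangentSpace I x) := inferInstanceAs (FiniteDimensional ℝ E)
  have complexLinearPart_diff :
      complexLinearPart (S.J x) (diff D Dbar x u) = etaHat S D Dbar x u • S.J x :=
    complexLinearPart_eq_of_perp_su hn hdim (S.isOrthComplex x) (hDbar.perp x u).1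
      fun B skew comm traceless ↦ (hDbar.perp x u).2 B ⟨skew, comm, traceless⟩
  rw [xi_eq_diff_sub_complexLinearPart hDbar, complexLinearPart_diff,
    smul_apply, sub_add_cancel]

theorem nablaTilde_eq (hDbar : IsMinimalSU S D Dbar) (hY : SmoothNear Y x)
    (u : TangentSpace I x) :
    nablaTilde S D Y x u = Dbar Y x u - etaHat S D Dbar x u • S.J x (Y x) := by
  have diff_Y := diff_eq_xi_add_etaHat hn hdim hDbar u (Y x)
  rw [diff_apply u hY] at diff_Y
  rw [nablaTilde]
  linear_combination (norm := module) -diff_Y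

theorem smoothFunNear_etaHat (hD : IsSmooth D) (hDbar : IsMinimalSU S D Dbar)
    (hX : SmoothNear X x) : SmoothFunNear I (fun y ↦ etaHat S D Dbar y (X y)) x := by
  have : Nontrivial E := Module.nontrivial_of_finrank_pos (R := ℝ) (by omega)
  -- `η̂(X) W = (∇̃ - ∇̄)_X (J W)`
  refine SmoothFunNear.of_smul fun W hW ↦ ((SmoothNear.nablaTilde (S := S) hD hX (hW.J S)).sub
    (SmoothNear.connection hDbar.smooth hX (hW.J S))).congr ?_
  filter_upwards [hW.eventually] with y h
  rw [nablaTilde_eq hn hdim hDbar (h.J S), S.J_J]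
  module

theorem nablaTilde_J (hDbar : IsMinimalSU S D Dbar) (hY : SmoothNear Y x) (u : TangentSpace I x) :
    nablaTilde S D (fun y ↦ S.J y (Y y)) x u = S.J x (nablaTilde S D Y x u) := by
  rw [nablaTilde_eq hn hdim hDbar (hY.J S), nablaTilde_eq hn hdim hDbar hY,
    hDbar.parallel_J _ x u hY.contMDiffAt, map_sub, map_smul]

theorem nablaXi_J (hD : IsSmooth D) (hDbar : IsMinimalSU S D Dbar) (u v w : TangentSpace I x) :
    nablaXi S D x u v (S.J x w) = -S.J x (nablaXi S D x u v w) := by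
  have hw := smoothNear_ext w
  have hxi : SmoothNear (fun y ↦ xi S D y (ext v y) (ext w y)) x :=
    SmoothNear.xi hD (smoothNear_ext v) hw
  have nablaXi_Jw := nablaXi_apply (S := S) hD u v (hw.J S)
  simp only [xi_J, ext_self] at nablaXi_Jw
  rw [nablaTilde_neg (hxi.J S), nablaTilde_J hn hdim hDbar hxi, nablaTilde_J hn hdim hDbar hw,
    xi_J] at nablaXi_Jw
  rw [nablaXi_Jw, nablaXi]
  simp only [map_sub]
  abel

end MinimalSU

section TorsionCurvature

/-- The curvature operator `R̃_{X,Y} Z` of the minimal `U(n)`-connection `∇̃ = ∇ + ξ`, with the sign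
convention of `curvatureOp`. -/
def curvatureTilde (S : SpecialAlmostHermitian n I M) (D : Connection I M)
    (X Y Z : Π x : M, TangentSpace I x) (x : M) : TangentSpace I x :=
  nablaTilde S D Z x (mlieBracket I X Y x)
    - nablaTilde S D (fun y ↦ nablaTilde S D Z y (Y y)) x (X x)
    + nablaTilde S D (fun y ↦ nablaTilde S D Z y (X y)) x (Y x)

theorem connection_connection_eq (hD : IsSmooth D) (u v : TangentSpace I x)
    (hZ : SmoothNear Z x) :
    D (fun y ↦ D Z y (ext v y)) x u =
      nablaTilde S D (fun y ↦ nablaTilde S D Z y (ext v y)) x u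
      - xi S D x u (nablaTilde S D Z x v)
      - (nablaXi S D x u v (Z x) + xi S D x (nablaTilde S D (ext v) x u) (Z x)
        + xi S D x v (nablaTilde S D Z x u))
      + xi S D x u (xi S D x v (Z x)) := by
  have hv := smoothNear_ext v
  have hDZ := SmoothNear.connection hD hv hZ
  have hxi := SmoothNear.xi (S := S) hD hv hZ
  have nablaTilde_add_DZ : nablaTilde S D (fun y ↦ nablaTilde S D Z y (ext v y)) x u =
      nablaTilde S D (fun y ↦ D Z y (ext v y)) x u
        + nablaTilde S D (fun y ↦ xi S D y (ext v y) (Z y)) x u := nablaTilde_add hDZ hxi u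
  have nablaTilde_DZ : nablaTilde S D (fun y ↦ D Z y (ext v y)) x u =
      D (fun y ↦ D Z y (ext v y)) x u + xi S D x u (D Z x v) := by rw [nablaTilde, ext_self]
  have xi_nablaTilde : xi S D x u (nablaTilde S D Z x v) =
      xi S D x u (D Z x v) + xi S D x u (xi S D x v (Z x)) := (isLinearMap_xi u).map_add _ _
  rw [nablaXi_apply hD u v hZ, xi_nablaTilde]
  linear_combination (norm := module) -nablaTilde_add_DZ - nablaTilde_DZ

theorem curvatureOp_eq_curvatureTilde (hD : IsSmooth D) (hD₀ : D.torsion = 0)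
    (u v : TangentSpace I x) (hZ : SmoothNear Z x) :
    curvatureOp D (ext u) (ext v) Z x = curvatureTilde S D (ext u) (ext v) Z x
      + (nablaXi S D x u v (Z x) - nablaXi S D x v u (Z x) + xi S D x (xi S D x u v) (Z x)
        - xi S D x (xi S D x v u) (Z x))
      - (xi S D x u (xi S D x v (Z x)) - xi S D x v (xi S D x u (Z x))) := by
  have torsion_tilde : nablaTilde S D (ext v) x u - nablaTilde S D (ext u) x v =
      mlieBracket I (ext u) (ext v) x + xi S D x u v - xi S D x v u := by
    have h := connection_sub_swap hD₀ (smoothNear_ext u) (smoothNear_ext v)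
    rw [ext_self, ext_self] at h
    simp only [nablaTilde, ext_self]
    linear_combination (norm := module) h
  have xi_torsion_tilde := congr(xi S D x $torsion_tilde (Z x))
  rw [xi_sub_left, xi_sub_left, xi_add_left] at xi_torsion_tilde
  simp only [curvatureOp, curvatureTilde, ext_self]
  rw [connection_connection_eq (S := S) hD u v hZ, connection_connection_eq (S := S) hD v u hZ]
  have nablaTilde_bracket : nablaTilde S D Z x (mlieBracket I (ext u) (ext v) x) =
      D Z x (mlieBracket I (ext u) (ext v) x)
        + xi S D x (mlieBracket I (ext u) (ext v) x) (Z x) := rfl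
  linear_combination (norm := module) xi_torsion_tilde - nablaTilde_bracket

variable (hn : n ≠ 0) (hdim : Module.finrank ℝ E = 2 * n)
include hn hdim

theorem nablaTilde_nablaTilde_eq (hD : IsSmooth D) (hDbar : IsMinimalSU S D Dbar)
    (hY : SmoothNear Y x) (hZ : SmoothNear Z x) (u : TangentSpace I x) :
    nablaTilde S D (fun y ↦ nablaTilde S D Z y (Y y)) x u =
      Dbar (fun y ↦ Dbar Z y (Y y)) x u - etaHat S D Dbar x (Y x) • S.J x (Dbar Z x u)
      - etaHat S D Dbar x u • S.J x (Dbar Z x (Y x))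
      - d% (fun y ↦ etaHat S D Dbar y (Y y)) x u • S.J x (Z x)
      - (etaHat S D Dbar x u * etaHat S D Dbar x (Y x)) • Z x := by
  have hDbarZ := SmoothNear.connection hDbar.smooth hY hZ
  have heta := smoothFunNear_etaHat hn hdim hD hDbar hY
  have hetaJ := SmoothNear.smul heta (hZ.J S)
  have nablaTilde_Z : ∀ᶠ y in 𝓝 x, nablaTilde S D Z y (Y y) =
      Dbar Z y (Y y) - etaHat S D Dbar y (Y y) • S.J y (Z y) := by
    filter_upwards [hZ.eventually] with y h using nablaTilde_eq hn hdim hDbar h _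
  rw [nablaTilde_congr (SmoothNear.nablaTilde hD hY hZ) nablaTilde_Z,
    nablaTilde_eq hn hdim hDbar (hDbarZ.sub hetaJ), connection_sub Dbar hDbarZ hetaJ,
    connection_smul Dbar heta (hZ.J S), hDbar.parallel_J _ x u hZ.contMDiffAt]
  simp only [map_sub, map_smul, S.J_J]
  module

theorem curvatureTilde_eq (hD : IsSmooth D) (hDbar : IsMinimalSU S D Dbar)
    (u v : TangentSpace I x) (hZ : SmoothNear Z x) :
    curvatureTilde S D (ext u) (ext v) Z x =
      curvatureOp Dbar (ext u) (ext v) Z x + dOne (etaHat S D Dbar) x u v • S.J x (Z x) := by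
  have hu := smoothNear_ext u
  have hv := smoothNear_ext v
  simp only [curvatureTilde, curvatureOp, dOne]
  rw [nablaTilde_nablaTilde_eq hn hdim hD hDbar hv hZ,
    nablaTilde_nablaTilde_eq hn hdim hD hDbar hu hZ, nablaTilde_eq hn hdim hDbar hZ]
  simp only [ext_self]
  module

end TorsionCurvature

end MinimalConnection

theorem sum_sum_erase_update_swap {ι α A : Type*} [Fintype ι] [DecidableEq ι] [AddCommMonoid A]
    (φ : (ι → α) → A) (w a b : ι → α) :
    ∑ i, ∑ j ∈ Finset.univ.erase i, φ (Function.update (Function.update w i (a i)) j (b j)) =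
      ∑ i, ∑ j ∈ Finset.univ.erase i, φ (Function.update (Function.update w i (b i)) j (a j)) := by
  rw [Finset.sum_comm' (t' := Finset.univ) (s' := fun i ↦ Finset.univ.erase i)
    (fun i j ↦ by simp [eq_comm])]
  refine Finset.sum_congr rfl fun i _ ↦ Finset.sum_congr rfl fun j hj ↦ ?_
  rw [Function.update_comm (Finset.ne_of_mem_erase hj)]

theorem update_pi_apply {ι α : Type*} {β : α → Type*} [DecidableEq ι] (Y : ι → Π a, β a) (i : ι)
    (Z : Π a, β a) (a : α) :
    (fun j ↦ Function.update Y i Z j a) = Function.update (fun j ↦ Y j a) i (Z a) :=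
  funext fun j ↦ Function.apply_update (fun _ (X : Π a, β a) ↦ X a) Y i Z j

section VolumeForm

open Filter Topology

variable {E : Type*} [NormedAddCommGroup E] [NormedSpace ℝ E]
  {H : Type*} [TopologicalSpace H] {I : ModelWithCorners ℝ E H}
  {M : Type*} [TopologicalSpace M] [ChartedSpace H M] {x : M}

theorem mvfderiv_clm_comp {F G : Type*} [NormedAddCommGroup F] [NormedSpace ℝ F]
    [NormedAddCommGroup G] [NormedSpace ℝ G] (L : F →L[ℝ] G) {f : M → F} (hf : MDiffAt f x)
    (u : TangentSpace I x) : d% (fun y ↦ L (f y)) x u = L (d% f x u) := by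
  have hL : MDiffAt (L : F → G) (f x) := L.differentiableAt.mdifferentiableAt
  have h := mfderiv_comp (I := I) (I' := 𝓘(ℝ, F)) (I'' := 𝓘(ℝ, G)) x hL hf
  rw [L.mfderiv_eq] at h
  exact congr($h u)

theorem mvfderiv_sum {F : Type*} [NormedAddCommGroup F] [NormedSpace ℝ F] {ι : Type}
    {s : Finset ι} {f : ι → M → F} (hf : ∀ i ∈ s, MDiffAt (f i) x) (u : TangentSpace I x) :
    d% (fun y ↦ ∑ i ∈ s, f i y) x u = ∑ i ∈ s, d% (f i) x u := by
  have h := (HasMFDerivAt.sum fun i hi ↦ (hf i hi).hasMFDerivAt).mfderiv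
  rw [Finset.sum_fn] at h
  exact congr($h u).trans (sum_apply _ _ _)

variable {n : ℕ} [IsManifold I ∞ M] [RiemannianBundle (fun x : M ↦ TangentSpace I x)]
  {S : SpecialAlmostHermitian n I M} {Dbar : Connection I M}

section Frames

variable {Y : Fin n → Π x : M, TangentSpace I x} {U V : Π x : M, TangentSpace I x}

theorem smoothFunNear_clm_Ψ (L : ℂ →L[ℝ] ℝ) (hY : ∀ i, SmoothNear (Y i) x) :
    SmoothFunNear I (fun y ↦ L (S.Ψ y fun i ↦ Y i y)) x := by
  filter_upwards [eventually_all.mpr hY] with y h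
  exact L.contMDiff.contMDiffAt.comp y (S.Ψ_smooth Y y h)

variable [FiniteDimensional ℝ E]

theorem mvfderiv_clm_Ψ (L : ℂ →L[ℝ] ℝ) (hDbar : IsMinimalSU S D Dbar)
    (hY : ∀ i, CMDiffAt ∞ (T% (Y i)) x) (u : TangentSpace I x) :
    d% (fun y ↦ L (S.Ψ y fun i ↦ Y i y)) x u =
      ∑ i, L (S.Ψ x (Function.update (fun j ↦ Y j x) i (Dbar (Y i) x u))) := by
  rw [mvfderiv_clm_comp L ((S.Ψ_smooth Y x hY).mdifferentiableAt (by simp)),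
    hDbar.parallel_Ψ Y x u hY, map_sum]

theorem mvfderiv_mvfderiv_clm_Ψ (L : ℂ →L[ℝ] ℝ) (hDbar : IsMinimalSU S D Dbar)
    (hY : ∀ i, SmoothNear (Y i) x) (hV : SmoothNear V x) (u : TangentSpace I x) :
    d% (fun y ↦ d% (fun z ↦ L (S.Ψ z fun i ↦ Y i z)) y (V y)) x u =
      ∑ i, L (S.Ψ x (Function.update (fun j ↦ Y j x) i (Dbar (fun y ↦ Dbar (Y i) y (V y)) x u)))
      + ∑ i, ∑ j ∈ Finset.univ.erase i, L (S.Ψ x (Function.update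
        (Function.update (fun j ↦ Y j x) i (Dbar (Y i) x (V x))) j (Dbar (Y j) x u))) := by
  let DY (i : Fin n) : Fin n → Π x : M, TangentSpace I x :=
    Function.update Y i fun y ↦ Dbar (Y i) y (V y)
  have hDY : ∀ i j, SmoothNear (DY i j) x := fun i j ↦ by
    rcases eq_or_ne j i with rfl | h
    · simpa [DY] using SmoothNear.connection hDbar.smooth hV (hY j)
    · simpa [DY, h] using hY j
  have mvfderiv_eq : (fun y ↦ d% (fun z ↦ L (S.Ψ z fun i ↦ Y i z)) y (V y)) =ᶠ[𝓝 x]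
      fun y ↦ ∑ i, L (S.Ψ y fun j ↦ DY i j y) := by
    filter_upwards [eventually_all.mpr hY] with y h
    simp only [mvfderiv_clm_Ψ L hDbar h, DY, update_pi_apply]
  rw [mvfderiv_congr mvfderiv_eq,
    mvfderiv_sum (fun i _ ↦ (smoothFunNear_clm_Ψ L (hDY i)).mdiffAt) u, ← Finset.sum_add_distrib]
  refine Finset.sum_congr rfl fun i _ ↦ ?_
  rw [mvfderiv_clm_Ψ L hDbar (fun j ↦ (hDY i j).contMDiffAt),
    ← Finset.add_sum_erase _ _ (Finset.mem_univ i)]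
  simp only [DY, update_pi_apply, Function.update_idem, Function.update_self]
  congr 1
  refine Finset.sum_congr rfl fun j hj ↦ ?_
  rw [Function.update_of_ne (Finset.ne_of_mem_erase hj)]

theorem sum_Ψ_update_curvatureOp (hDbar : IsMinimalSU S D Dbar)
    (hY : ∀ i, SmoothNear (Y i) x) (hU : SmoothNear U x) (hV : SmoothNear V x) :
    ∑ i, S.Ψ x (Function.update (fun j ↦ Y j x) i (curvatureOp Dbar U V (Y i) x)) = 0 := by
  have map_sum_eq_zero : ∀ L : ℂ →L[ℝ] ℝ, L (∑ i, S.Ψ x (Function.update (fun j ↦ Y j x) i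
      (curvatureOp Dbar U V (Y i) x))) = 0 := fun L ↦ by
    have commutator := mvfderiv_mvfderiv_sub_swap (smoothFunNear_clm_Ψ (S := S) L hY) hU hV
    rw [mvfderiv_mvfderiv_clm_Ψ L hDbar hY hV, mvfderiv_mvfderiv_clm_Ψ L hDbar hY hU,
      mvfderiv_clm_Ψ L hDbar fun i ↦ (hY i).contMDiffAt,
      sum_sum_erase_update_swap (fun w ↦ L (S.Ψ x w)) (fun j ↦ Y j x)] at commutator
    simp only [curvatureOp, AlternatingMap.map_update_add, AlternatingMap.map_update_sub, map_sum,
      map_add, map_sub, Finset.sum_add_distrib, Finset.sum_sub_distrib]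
    linarith
  exact Complex.ext (map_sum_eq_zero Complex.reCLM) (map_sum_eq_zero Complex.imCLM)

end Frames

variable [FiniteDimensional ℝ E]

theorem curvatureOp_J (hDbar : IsMinimalSU S D Dbar) (u v w : TangentSpace I x) :
    curvatureOp Dbar (ext u) (ext v) (ext (S.J x w)) x =
      S.J x (curvatureOp Dbar (ext u) (ext v) (ext w) x) := by
  have hw := smoothNear_ext w
  have connection_connection_J : ∀ {V : Π x : M, TangentSpace I x}, SmoothNear V x → ∀ u,
      Dbar (fun y ↦ Dbar (fun z ↦ S.J z (ext w z)) y (V y)) x u =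
        S.J x (Dbar (fun y ↦ Dbar (ext w) y (V y)) x u) := fun hV u ↦ by
    rw [← hDbar.parallel_J _ x u (SmoothNear.connection hDbar.smooth hV hw).contMDiffAt]
    refine connection_congr Dbar (SmoothNear.connection hDbar.smooth hV (hw.J S)) ?_ u
    filter_upwards [hw] with y hy using hDbar.parallel_J _ y _ hy
  have curvatureOp_ext_J := (curvatureOp_tensorial_right hDbar.smooth (smoothNear_ext u)
    (smoothNear_ext v)).pointwise (smoothNear_ext (S.J x w)) (hw.J S) (by simp only [ext_self])
  rw [curvatureOp_ext_J]
  simp only [curvatureOp, map_add, map_sub]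
  rw [connection_connection_J (smoothNear_ext u), connection_connection_J (smoothNear_ext v),
    hDbar.parallel_J _ x _ hw.contMDiffAt]

theorem sum_inner_curvatureOp_J (hdim : Module.finrank ℝ E = 2 * n) (hDbar : IsMinimalSU S D Dbar)
    (u v : TangentSpace I x) {ι : Type*} [Fintype ι]
    (e : OrthonormalBasis ι ℝ (TangentSpace I x)) :
    ∑ i, inner ℝ (curvatureOp Dbar (ext u) (ext v) (ext (e i)) x) (S.J x (e i)) = (0 : ℝ) := by
  have : FiniteDimensional ℝ (TangentSpace I x) := inferInstanceAs (FiniteDimensional ℝ E)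
  refine sum_inner_J_eq_zero_of_alternating e (S.isOrthComplex x) hdim (S.Ψ_J x)
    (fun f hf hf₀ ↦ ?_) (isLinearMap_curvatureOp_ext hDbar.smooth u v) (curvatureOp_J hDbar u v)
    fun w ↦ ?_
  · have unit := S.Ψ_unit x f hf.1 hf.2
    rw [hf₀, norm_zero] at unit
    exact zero_ne_one unit
  · have h := sum_Ψ_update_curvatureOp hDbar (fun i ↦ smoothNear_ext (w i)) (smoothNear_ext u)
      (smoothNear_ext v)
    simpa only [ext_self] using h

end VolumeForm

section Decomposition

variable {n : ℕ} {E : Type*} [NormedAddCommGroup E] [NormedSpace ℝ E] [FiniteDimensional ℝ E]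
  {H : Type*} [TopologicalSpace H] {I : ModelWithCorners ℝ E H}
  {M : Type*} [TopologicalSpace M] [ChartedSpace H M] [IsManifold I ∞ M]
  [RiemannianBundle (fun x : M ↦ TangentSpace I x)]
  {S : SpecialAlmostHermitian n I M} {D Dbar : Connection I M} {x : M}

theorem isTorsionDecomposition_riem (hn : n ≠ 0) (hdim : Module.finrank ℝ E = 2 * n)
    (hD : IsLeviCivita D) (hDbar : IsMinimalSU S D Dbar) {ι : Type*} [Fintype ι]
    (e : OrthonormalBasis ι ℝ (TangentSpace I x)) :
    IsTorsionDecomposition (S.J x) e (riem D x)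
      (fun u v w ↦ curvatureOp Dbar (ext u) (ext v) (ext w) x) (nablaXi S D x) (xi S D x)
      (dOne (etaHat S D Dbar) x) where
  curvature_J := curvatureOp_J hDbar
  sum_curvature u v := sum_inner_curvatureOp_J hdim hDbar u v e
  nabla_linear := isLinearMap_nablaXi hD.smooth
  nabla_J := nablaXi_J hn hdim hD.smooth hDbar
  linear := isLinearMap_xi
  map_J := xi_J
  skew := inner_xi hD.metric
  eq u v w z := by
    rw [riem, curvatureOp_eq_curvatureTilde hD.smooth hD.torsion_free u v (smoothNear_ext w),
      curvatureTilde_eq hn hdim hD.smooth hDbar u v (smoothNear_ext w), ext_self]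

end Decomposition

end SAH

end

theorem lemma3p6_general {n : ℕ} (hn : n ≠ 0) {E : Type*} [NormedAddCommGroup E]
    [NormedSpace ℝ E] [FiniteDimensional ℝ E] {H : Type*} [TopologicalSpace H]
    {I : ModelWithCorners ℝ E H} {M : Type*} [TopologicalSpace M] [ChartedSpace H M]
    [IsManifold I ∞ M] [RiemannianBundle (fun x : M ↦ TangentSpace I x)]
    [IsContMDiffRiemannianBundle I ∞ E (fun x : M ↦ TangentSpace I x)]
    (S : SAH.SpecialAlmostHermitian n I M) (D Dbar : SAH.Connection I M)
    (hD : SAH.IsLeviCivita D) (hDbar : SAH.IsMinimalSU S D Dbar)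
    (x : M) (e : OrthonormalBasis (Fin (2 * n)) ℝ (TangentSpace I x)) :
    (∀ u v : TangentSpace I x, SAH.diff D Dbar x u v =
      SAH.xi S D x u v + SAH.etaHat S D Dbar x u • S.J x v) ∧
    (∀ X Y : TangentSpace I x,
      3 * SAH.hermPart (S.J x) (SAH.ricStar S D x e) X Y
        + SAH.hermPart (S.J x) (SAH.ric D x e) X Y =
      SAH.torsionForm S D Dbar x e X Y) ∧
    SAH.IsComponent e (SAH.IsK1 (S.J x) e) (SAH.riem D x)
      (fun a b c d ↦ SAH.tr e (SAH.torsionForm S D Dbar x e) / (32 * n * (n + 1)) *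
        SAH.kahlerOf (S.J x) (fun u v ↦ inner ℝ u v) a b c d) ∧
    SAH.IsComponent e (SAH.IsK2 (S.J x) e) (SAH.riem D x)
      (fun a b c d ↦ 1 / (8 * (n + 2)) *
        SAH.kahlerOf (S.J x) (fun u v ↦ SAH.torsionForm S D Dbar x e u v
          - SAH.tr e (SAH.torsionForm S D Dbar x e) / (2 * n) * inner ℝ u v) a b c d) := by
  have hdim : Module.finrank ℝ E = 2 * n :=
    (Module.finrank_eq_card_basis e.toBasis).trans (Fintype.card_fin _)
  have hJ := S.isOrthComplex x
  have hR := SAH.isCurvature_riem hD x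
  have ricci_eq : ∀ X Y : TangentSpace I x,
      3 * SAH.hermPart (S.J x) (SAH.ricStar S D x e) X Y
        + SAH.hermPart (S.J x) (SAH.ric D x e) X Y = SAH.torsionForm S D Dbar x e X Y :=
    (SAH.isTorsionDecomposition_riem hn hdim hD hDbar e).three_ricciStarOf_add_ricciOf hJ hR
  have herm : SAH.IsHermForm (S.J x) (SAH.torsionForm S D Dbar x e) := by
    rw [← funext₂ ricci_eq]
    exact hR.isHermForm_three_ricciStarOf_add_ricciOf e hJ
  have pair_eq : ∀ b, SAH.IsHermForm (S.J x) b → SAH.pair e (SAH.riem D x)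
      (SAH.kahlerOf (S.J x) b) = 4 * SAH.pair₂ e (SAH.torsionForm S D Dbar x e) b := by
    rw [← funext₂ ricci_eq]
    exact fun b ↦ hR.pair_kahlerOf_hermPart e hJ
  exact ⟨SAH.diff_eq_xi_add_etaHat hn hdim hDbar, ricci_eq,
    SAH.isComponent_K1 e hn hJ herm pair_eq, SAH.isComponent_K2 e hn hJ herm pair_eq⟩

theorem lemma3p6 {n : ℕ} (hn : 2 ≤ n) {M : Type*} [TopologicalSpace M] [T2Space M]
    [ChartedSpace (EuclideanSpace ℝ (Fin (2 * n))) M]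
    [IsManifold (𝓡 (2 * n)) ∞ M]
    [RiemannianBundle (fun x : M ↦ TangentSpace (𝓡 (2 * n)) x)]
    [IsContMDiffRiemannianBundle (𝓡 (2 * n)) ∞ (EuclideanSpace ℝ (Fin (2 * n)))
      (fun x : M ↦ TangentSpace (𝓡 (2 * n)) x)]
    (S : SAH.SpecialAlmostHermitian n (𝓡 (2 * n)) M) (D Dbar : SAH.Connection (𝓡 (2 * n)) M)
    (hD : SAH.IsLeviCivita D) (hDbar : SAH.IsMinimalSU S D Dbar)
    (x : M) (e : OrthonormalBasis (Fin (2 * n)) ℝ (TangentSpace (𝓡 (2 * n)) x)) :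
    -- the minimal connection is `∇̄ = ∇ + ξ + η` with `η_u v = η̂(u) J v`
    (∀ u v : TangentSpace (𝓡 (2 * n)) x, SAH.diff D Dbar x u v =
      SAH.xi S D x u v + SAH.etaHat S D Dbar x u • S.J x v) ∧
    -- `3 Ric*_H + Ric_H` in terms of the intrinsic torsion
    (∀ X Y : TangentSpace (𝓡 (2 * n)) x,
      3 * SAH.hermPart (S.J x) (SAH.ricStar S D x e) X Y
        + SAH.hermPart (S.J x) (SAH.ric D x e) X Y =
      SAH.torsionForm S D Dbar x e X Y) ∧
    -- the component of the curvature in `𝒦₁`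
    SAH.IsComponent e (SAH.IsK1 (S.J x) e) (SAH.riem D x)
      (fun a b c d ↦ SAH.tr e (SAH.torsionForm S D Dbar x e) / (32 * n * (n + 1)) *
        SAH.kahlerOf (S.J x) (fun u v ↦ inner ℝ u v) a b c d) ∧
    -- the component of the curvature in `𝒦₂`
    SAH.IsComponent e (SAH.IsK2 (S.J x) e) (SAH.riem D x)
      (fun a b c d ↦ 1 / (8 * (n + 2)) *
        SAH.kahlerOf (S.J x) (fun u v ↦ SAH.torsionForm S D Dbar x e u v
          - SAH.tr e (SAH.torsionForm S D Dbar x e) / (2 * n) * inner ℝ u v) a b c d) :=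
  lemma3p6_general (by omega) S D Dbar hD hDbar x e
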